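/- Let $\omega,\lambda>0$ with $\omega>2\lambda$, let $\alpha\neq\beta$ be real numbers, and put $\theta_0=\frac12\tanh^{-1}\!\left(\frac{2\lambda}{\omega}\right)$. In $L^2(\mathbb R)$, with $\langle f,g\rangle=\int_{\mathbb R}\overline{f(x)}\,g(x)\,dx$, let $c=\frac1{\sqrt2}\left(\frac{d}{dx}+x\right)$ and $c^\dagger=\frac1{\sqrt2}\left(-\frac{d}{dx}+x\right)$ be the bosonic operators on their natural (maximal, distributional) domains, and let $$a=c+\alpha,\quad b=c^\dagger+\beta,\quad A=a\cosh\theta_0+b\sinh\theta_0,\quad B=b\cosh\theta_0+a\sinh\theta_0,\quad N=BA,$$ where sums and products of operators have their natural domains and $T^\dagger$ is the Hilbert space adjoint of a densely defined operator $T$. Put $$\Theta_\pm=\frac{e^{\pm\theta_0}}{\sqrt2},\quad \gamma_A=\alpha\cosh\theta_0+\beta\sinh\theta_0,\quad \gamma_B=\beta\cosh\theta_0+\alpha\sinh\theta_0,\quad k=\Theta_-(\gamma_A+\gamma_B)=\frac{\alpha+\beta}{\sqrt2},$$ and, with $H_n$ the (physicists') Hermite polynomials, $$\varphi_n(x)=\frac{N_\varphi}{\sqrt{2^n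 n!}}H_n\!\left(\frac{x+k}{\sqrt2\,\Theta_-}\right)e^{-\frac{\Theta_+}{2\Theta_-}x^2-\frac{\gamma_A}{\Theta_-}x},\qquad \psi_n(x)=\frac{N_\psi}{\sqrt{2^n n!}}H_n\!\left(\frac{x+k}{\sqrt2\,\Theta_-}\right)e^{-\frac{\Theta_+}{2\Theta_-}x^2-\frac{\gamma_B}{\Theta_-}x},\qquad n\ge 0,$$ where $N_\varphi,N_\psi$ are real constants normalised by $$N_\varphi N_\psi=\frac{e^{-k^2/(2\Theta_-^2)}}{\sqrt{2\pi}\,\Theta_-}$$ (for instance $N_\varphi=N_\psi=\dfrac{e^{-k^2/(4\Theta_-^2)}}{(2\pi)^{1/4}\sqrt{\Theta_-}}$). Then all $\varphi_n$ and $\psi_n$ belong to $L^2(\mathbb R)$ and: 1. $\varphi_n$ and $\psi_n$ are eigenvectors of $N$ and $N^\dagger$ respectively: they are non-zero, $\varphi_n\in D(N)$ with $N\varphi_n=n\varphi_n$, and $\psi_n\in D(N^\dagger)\cap D(A^\dagger B^\dagger)$ with $N^\dagger\psi_n=A^\dagger B^\dagger\psi_n=n\psi_n$. 2. With $L_n$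 the Laguerre polynomials, $$\|\varphi_n\|^2=\frac{N_\varphi}{N_\psi}\,e^{\frac12(3\gamma_A^2-\gamma_B^2-2\gamma_A\gamma_B)}\,L_n\!\left(-(\gamma_B-\gamma_A)^2\right),\qquad \|\psi_n\|^2=\frac{N_\psi}{N_\varphi}\,e^{\frac12(3\gamma_B^2-\gamma_A^2-2\gamma_A\gamma_B)}\,L_n\!\left(-(\gamma_B-\gamma_A)^2\right),$$ and $\|\varphi_n\|\,\|\psi_n\|\to\infty$ as $n\to\infty$. 3. $\{\varphi_n\}$ and $\{\psi_n\}$ are each complete in $L^2(\mathbb R)$: their linear spans are dense. 4. They are biorthonormal: $\langle\varphi_n,\psi_m\rangle=\delta_{n,m}$ for all $n,m\ge0$. 5. Neither is a (Schauder) basis of $L^2(\mathbb R)$, i.e. it is not true that every $f\in L^2(\mathbb R)$ has a unique norm-convergent expansion $f=\sum_{n\ge0} c_n\varphi_n$, and likewise for $\{\psi_n\}$. 6. They are $\mathcal G$-quasi bases, where $\mathcal G=\{f\in L^2(\mathbb R): e^{qx}f(x)\in L^2(\mathbb R)\ \text{for all } q\in\mathbb R\}$: $\mathcal G$ is a dense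 subspace of $L^2(\mathbb R)$ and, for all $f,g\in\mathcal G$, $$\langle f,g\rangle=\sum_{n\ge0}\langle f,\varphi_n\rangle\langle\psi_n,g\rangle=\sum_{n\ge0}\langle f,\psi_n\rangle\langle\varphi_n,g\rangle,$$ both series converging absolutely. -/

import Mathlib

open MeasureTheory Filter Topology
open scoped SchwartzMap

noncomputable section

namespace Swanson

/-- The Hilbert space `L²(ℝ)` of complex-valued functions, for Lebesgue measure. Its inner product
`inner ℂ f g = ∫ conj (f x) * g x` is linear in the second argument. -/
abbrev L2 : Type := Lp ℂ 2 (volume : Measure ℝ)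

/-! ### Unbounded operators -/

/-- A linear map of the Schwartz space into itself, viewed as an unbounded operator in `L²(ℝ)`
whose domain is the Schwartz space. -/
def schwartzOp (D : 𝓢(ℝ, ℂ) →ₗ[ℂ] 𝓢(ℝ, ℂ)) : L2 →ₗ.[ℂ] L2 where
  domain := LinearMap.range (SchwartzMap.toLpCLM ℂ ℂ 2 (volume : Measure ℝ)).toLinearMap
  toFun := (SchwartzMap.toLpCLM ℂ ℂ 2 (volume : Measure ℝ)).toLinearMap ∘ₗ D ∘ₗ
    (LinearEquiv.ofInjective (SchwartzMap.toLpCLM ℂ ℂ 2 (volume : Measure ℝ)).toLinearMap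
      (SchwartzMap.injective_toLp 2 volume)).symm.toLinearMap

/-- The differential expression `(d/dx + x) / √2` on Schwartz functions. -/
def lowering : 𝓢(ℝ, ℂ) →ₗ[ℂ] 𝓢(ℝ, ℂ) :=
  ((1 / √2 : ℝ) : ℂ) • (SchwartzMap.derivCLM ℂ ℂ
    + SchwartzMap.smulLeftCLM ℂ (fun x : ℝ => (x : ℂ))).toLinearMap

/-- The differential expression `(-d/dx + x) / √2` on Schwartz functions. -/
def raising : 𝓢(ℝ, ℂ) →ₗ[ℂ] 𝓢(ℝ, ℂ) :=
  ((1 / √2 : ℝ) : ℂ) • (-SchwartzMap.derivCLM ℂ ℂ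
    + SchwartzMap.smulLeftCLM ℂ (fun x : ℝ => (x : ℂ))).toLinearMap

theorem lowering_apply (f : 𝓢(ℝ, ℂ)) (x : ℝ) :
    lowering f x = ((1 / √2 : ℝ) : ℂ) * (deriv f x + x * f x) := by
  have h : (fun x : ℝ => (x : ℂ)).HasTemperateGrowth := by fun_prop
  simp [lowering, SchwartzMap.smulLeftCLM_apply_apply h, mul_add]

theorem raising_apply (f : 𝓢(ℝ, ℂ)) (x : ℝ) :
    raising f x = ((1 / √2 : ℝ) : ℂ) * (-deriv f x + x * f x) := by
  have h : (fun x : ℝ => (x : ℂ)).HasTemperateGrowth := by fun_prop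
  simp [raising, SchwartzMap.smulLeftCLM_apply_apply h, mul_add]

/-- The bosonic lowering operator `c = (d/dx + x) / √2` on its natural (maximal) domain: all `f` in
`L²(ℝ)` for which `(f' + x f) / √2`, computed in the sense of distributions against Schwartz
functions, belongs to `L²(ℝ)`. -/
def opc : L2 →ₗ.[ℂ] L2 := (schwartzOp raising).adjoint

/-- The bosonic raising operator `c† = (-d/dx + x) / √2` on its natural (maximal) domain: all `f`
in `L²(ℝ)` for which `(-f' + x f) / √2`, computed in the sense of distributions against Schwartz
functions, belongs to `L²(ℝ)`. -/
def opcDag : L2 →ₗ.[ℂ] L2 := (schwartzOp lowering).adjoint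

/-- The shifted operator `a = c + α 1`. -/
def opa (α : ℝ) : L2 →ₗ.[ℂ] L2 := ((α : ℂ) • (LinearMap.id : L2 →ₗ[ℂ] L2)) +ᵥ opc

/-- The shifted operator `b = c† + β 1`. -/
def opb (β : ℝ) : L2 →ₗ.[ℂ] L2 := ((β : ℂ) • (LinearMap.id : L2 →ₗ[ℂ] L2)) +ᵥ opcDag

/-- `A = cosh θ a + sinh θ b`, on the intersection of the domains of `a` and `b`. -/
def opA (θ α β : ℝ) : L2 →ₗ.[ℂ] L2 :=
  ((Real.cosh θ : ℝ) : ℂ) • opa α + ((Real.sinh θ : ℝ) : ℂ) • opb β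

/-- `B = cosh θ b + sinh θ a`, on the intersection of the domains of `a` and `b`. -/
def opB (θ α β : ℝ) : L2 →ₗ.[ℂ] L2 :=
  ((Real.cosh θ : ℝ) : ℂ) • opb β + ((Real.sinh θ : ℝ) : ℂ) • opa α

/-- The product `T S` of unbounded operators, with domain `{f ∈ D(S) : S f ∈ D(T)}`. -/
def opMul (T S : L2 →ₗ.[ℂ] L2) : L2 →ₗ.[ℂ] L2 where
  domain := (T.domain.comap S.toFun).map S.domain.subtype
  toFun :=
    { toFun := fun f => T ⟨S ⟨f.1, by
          obtain ⟨_, ⟨y, _, rfl⟩⟩ := f; exact y.2⟩, by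
          obtain ⟨_, ⟨y, hy, rfl⟩⟩ := f; exact hy⟩
      map_add' := fun f g => by
        rw [← T.map_add]; congr 1; apply Subtype.ext; exact S.map_add ⟨f.1, _⟩ ⟨g.1, _⟩
      map_smul' := fun r f => by
        rw [RingHom.id_apply, ← T.map_smul]; congr 1; apply Subtype.ext
        exact S.map_smul r ⟨f.1, _⟩ }

/-- The number-like operator `N = B A`. -/
def opN (θ α β : ℝ) : L2 →ₗ.[ℂ] L2 := opMul (opB θ α β) (opA θ α β)

/-- `v` is an eigenvector of the unbounded operator `T` with eigenvalue `μ`. -/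
def IsEigenvector (T : L2 →ₗ.[ℂ] L2) (μ : ℂ) (v : L2) : Prop :=
  v ≠ 0 ∧ ∃ hv : v ∈ T.domain, T ⟨v, hv⟩ = μ • v

/-! ### The constants and the explicit functions -/

/-- `Θ₊ = e^θ / √2`. -/
def thetaPlus (θ : ℝ) : ℝ := Real.exp θ / √2

/-- `Θ₋ = e^(-θ) / √2`. -/
def thetaMinus (θ : ℝ) : ℝ := Real.exp (-θ) / √2

/-- `γ_A = α cosh θ + β sinh θ`. -/
def gammaA (θ α β : ℝ) : ℝ := α * Real.cosh θ + β * Real.sinh θ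

/-- `γ_B = β cosh θ + α sinh θ`. -/
def gammaB (θ α β : ℝ) : ℝ := β * Real.cosh θ + α * Real.sinh θ

/-- `k = (α + β) / √2`. -/
def shiftK (α β : ℝ) : ℝ := (α + β) / √2

/-- The physicists' Hermite polynomials: `H₀ = 1`, `Hₙ₊₁ = 2 X Hₙ - Hₙ'`. -/
def hermiteH : ℕ → Polynomial ℝ
  | 0 => 1
  | n + 1 => 2 * Polynomial.X * hermiteH n - Polynomial.derivative (hermiteH n)

/-- The value at `x` of the `n`-th Laguerre polynomial. -/
def laguerreL (n : ℕ) (x : ℝ) : ℝ :=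
  ∑ j ∈ Finset.range (n + 1), (n.choose j : ℝ) * (-x) ^ j / (j.factorial : ℝ)

/-- The function `x ↦ c (2ⁿ n!)^(-1/2) Hₙ((x + k)/(√2 Θ₋)) exp(-(Θ₊/(2 Θ₋)) x² - (γ/Θ₋) x)`. -/
def hermiteGauss (θ k γ c : ℝ) (n : ℕ) (x : ℝ) : ℂ :=
  ((c / √(2 ^ n * (n.factorial : ℝ))
    * (hermiteH n).eval ((x + k) / (√2 * thetaMinus θ))
    * Real.exp (-(thetaPlus θ / (2 * thetaMinus θ)) * x ^ 2 - γ / thetaMinus θ * x) : ℝ) : ℂ)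

/-- The function `φₙ`, with normalisation constant `Nφ`. -/
def phi (θ α β Nφ : ℝ) : ℕ → ℝ → ℂ := hermiteGauss θ (shiftK α β) (gammaA θ α β) Nφ

/-- The function `ψₙ`, with normalisation constant `Nψ`. -/
def psi (θ α β Nψ : ℝ) : ℕ → ℝ → ℂ := hermiteGauss θ (shiftK α β) (gammaB θ α β) Nψ

/-! ### Completeness, bases and quasi-bases -/

/-- The family is complete (total): its linear span is dense. -/
def IsCompleteFamily (v : ℕ → L2) : Prop := Dense (Submodule.span ℂ (Set.range v) : Set L2)

/-- The two families are biorthonormal. -/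
def IsBiorthonormal (v w : ℕ → L2) : Prop :=
  ∀ n m, inner ℂ (v n) (w m) = if n = m then (1 : ℂ) else 0

/-- The sequence is a (Schauder) basis: every vector has exactly one norm-convergent expansion.
Continuity of the coefficients is not demanded, so that not being a basis in this sense is formally
the strongest form of the negation. -/
def IsBasis (v : ℕ → L2) : Prop :=
  ∀ f : L2, ∃! c : ℕ → ℂ,
    Tendsto (fun m => ∑ n ∈ Finset.range m, c n • v n) atTop (𝓝 f)

/-- The set `𝒢` of all `f ∈ L²(ℝ)` with `e^(q x) f ∈ L²(ℝ)` for every real `q`; it is a linear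
subspace. -/
def calG : Submodule ℂ L2 where
  carrier := {f | ∀ q : ℝ, MemLp (fun x : ℝ => (Real.exp (q * x) : ℂ) * f x) 2 volume}
  zero_mem' := fun q => by
    refine (MemLp.zero : MemLp (0 : ℝ → ℂ) 2 volume).ae_eq ?_
    filter_upwards [Lp.coeFn_zero ℂ 2 (volume : Measure ℝ)] with x hx
    rw [hx]
    simp
  add_mem' := fun {f g} hf hg q => by
    refine ((hf q).add (hg q)).ae_eq ?_
    filter_upwards [Lp.coeFn_add f g] with x hx
    rw [hx]
    simp only [Pi.add_apply, mul_add]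
  smul_mem' := fun r f hf q => by
    refine ((hf q).const_mul r).ae_eq ?_
    filter_upwards [Lp.coeFn_smul r f] with x hx
    simp only [hx, Pi.smul_apply, smul_eq_mul]
    ring

/-- `v` and `w` are `G`-quasi bases: `G` is a dense subspace and, for all `f, g ∈ G`,
`⟨f, g⟩ = ∑ ⟨f, vₙ⟩⟨wₙ, g⟩ = ∑ ⟨f, wₙ⟩⟨vₙ, g⟩`. -/
def IsQuasiBases (G : Submodule ℂ L2) (v w : ℕ → L2) : Prop :=
  Dense (G : Set L2) ∧ ∀ f ∈ G, ∀ g ∈ G,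
    HasSum (fun n => inner ℂ f (v n) * inner ℂ (w n) g) (inner ℂ f g) ∧
    HasSum (fun n => inner ℂ f (w n) * inner ℂ (v n) g) (inner ℂ f g)

end Swanson

end

noncomputable section

namespace Swanson

/-! All vectors involved are Schwartz functions of the form polynomial times Gaussian, on which `A`
and `B†` act as `downS` and `B` and `A†` as `upS`, with shift `γ_A` or `γ_B`. Conjugating by the
Gaussian turns these into ladder operators on Hermite polynomials, because `k / Θ₋ = γ_A + γ_B`;
this gives the eigenvalues (`upS_downS_hermiteGaussS`).

Completing the square reduces every inner product to Hermite polynomials with a shifted argument,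
integrated against `exp(-y²)` (`inner_hermiteGaussS`). For the mixed pairing the shift vanishes and
Hermite orthogonality gives biorthonormality; for the norms the addition formula gives a Laguerre
polynomial at a negative point, which grows at least linearly in `n` since `α ≠ β`. Uniform
boundedness of the rank-one maps `f ↦ ⟨ψₙ, f⟩ φₙ` would contradict this growth, so neither family is
a basis (`IsBiorthonormal.not_isBasis`).

Completeness is a moment problem: a function orthogonal to the family, times the Gaussian, has
exponential moments and vanishing power moments, hence zero Fourier transform. Finally, up to
constants, `φₙ` and `ψₙ` are `exp(q x) eₙ` and `exp(-q x) eₙ` for one orthonormal basis `eₙ`. On `𝒢`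
the exponentials move to the other factor and Parseval applies (`hasSum_inner_hermiteGaussS`). -/

/-- The class in `L²(ℝ)` of a Schwartz function. -/
abbrev toL2 (f : 𝓢(ℝ, ℂ)) : L2 := SchwartzMap.toLpCLM ℂ ℂ 2 (volume : Measure ℝ) f

theorem toL2_smul (c : ℂ) (f : 𝓢(ℝ, ℂ)) : toL2 (c • f) = c • toL2 f := map_smul _ c f

theorem coeFn_toL2 (f : 𝓢(ℝ, ℂ)) : toL2 f =ᵐ[volume] f := f.coeFn_toLp 2 volume

theorem inner_toL2 (f g : 𝓢(ℝ, ℂ)) :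
    inner ℂ (toL2 f) (toL2 g) = ∫ x, starRingEnd ℂ (f x) * g x := by
  have := SchwartzMap.inner_toL2_toL2_eq f g (volume : Measure ℝ)
  simp only [toL2, SchwartzMap.toLpCLM_apply]
  rw [this]
  simp [mul_comm]

theorem denseRange_toL2 : DenseRange toL2 :=
  SchwartzMap.denseRange_toLpCLM (by norm_num)

theorem integral_conj_deriv_mul (f g : 𝓢(ℝ, ℂ)) :
    ∫ x, starRingEnd ℂ (deriv f x) * g x = -∫ x, starRingEnd ℂ (f x) * deriv g x := by
  have := SchwartzMap.integral_bilinear_deriv_right_eq_neg_left f g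
    ((ContinuousLinearMap.mul ℝ ℂ).comp (Complex.conjCLE : ℂ →L[ℝ] ℂ))
  simp at this
  rw [this, neg_neg]

/-- Multiplication by `x` on Schwartz functions. -/
def mulX : 𝓢(ℝ, ℂ) →L[ℂ] 𝓢(ℝ, ℂ) := SchwartzMap.smulLeftCLM ℂ (fun x : ℝ => (x : ℂ))

theorem mulX_apply (f : 𝓢(ℝ, ℂ)) (x : ℝ) : mulX f x = x * f x := by
  have h : (fun x : ℝ => (x : ℂ)).HasTemperateGrowth := by fun_prop
  simp [mulX, SchwartzMap.smulLeftCLM_apply_apply h]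

theorem inner_derivCLM_left (f g : 𝓢(ℝ, ℂ)) :
    inner ℂ (toL2 (SchwartzMap.derivCLM ℂ ℂ f)) (toL2 g)
      = -inner ℂ (toL2 f) (toL2 (SchwartzMap.derivCLM ℂ ℂ g)) := by
  simp only [inner_toL2, SchwartzMap.derivCLM_apply, integral_conj_deriv_mul]

theorem inner_mulX_left (f g : 𝓢(ℝ, ℂ)) :
    inner ℂ (toL2 (mulX f)) (toL2 g) = inner ℂ (toL2 f) (toL2 (mulX g)) := by
  simp only [inner_toL2, mulX_apply, map_mul, Complex.conj_ofReal]
  congr 1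
  ext x
  ring

theorem lowering_eq (f : 𝓢(ℝ, ℂ)) :
    lowering f = ((1 / √2 : ℝ) : ℂ) • (SchwartzMap.derivCLM ℂ ℂ f + mulX f) := rfl

theorem raising_eq (f : 𝓢(ℝ, ℂ)) :
    raising f = ((1 / √2 : ℝ) : ℂ) • (-SchwartzMap.derivCLM ℂ ℂ f + mulX f) := rfl

theorem inner_lowering_left (f g : 𝓢(ℝ, ℂ)) :
    inner ℂ (toL2 (lowering f)) (toL2 g) = inner ℂ (toL2 f) (toL2 (raising g)) := by
  simp only [lowering_eq, raising_eq, toL2, map_smul, map_add, map_neg, inner_smul_left,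
    inner_smul_right, inner_add_left, inner_add_right, inner_neg_right, Complex.conj_ofReal]
  rw [inner_derivCLM_left, inner_mulX_left]

theorem inner_raising_left (f g : 𝓢(ℝ, ℂ)) :
    inner ℂ (toL2 (raising f)) (toL2 g) = inner ℂ (toL2 f) (toL2 (lowering g)) := by
  rw [← inner_conj_symm, ← inner_lowering_left, inner_conj_symm]

/-! ### Unbounded operators on Schwartz functions -/

theorem mem_schwartzOp_domain (D : 𝓢(ℝ, ℂ) →ₗ[ℂ] 𝓢(ℝ, ℂ)) (f : 𝓢(ℝ, ℂ)) :
    toL2 f ∈ (schwartzOp D).domain := ⟨f, rfl⟩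

theorem schwartzOp_apply (D : 𝓢(ℝ, ℂ) →ₗ[ℂ] 𝓢(ℝ, ℂ)) (f : 𝓢(ℝ, ℂ))
    (h : toL2 f ∈ (schwartzOp D).domain) : schwartzOp D ⟨toL2 f, h⟩ = toL2 (D f) := by
  have : (LinearEquiv.ofInjective (SchwartzMap.toLpCLM ℂ ℂ 2 (volume : Measure ℝ)).toLinearMap
      (SchwartzMap.injective_toLp 2 volume)).symm ⟨toL2 f, h⟩ = f := by
    rw [LinearEquiv.symm_apply_eq]; rfl
  change toL2 (D ((LinearEquiv.ofInjective
    (SchwartzMap.toLpCLM ℂ ℂ 2 (volume : Measure ℝ)).toLinearMap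
      (SchwartzMap.injective_toLp 2 volume)).symm ⟨toL2 f, h⟩)) = _
  rw [this]

/-- `T` maps the vector `f` of its domain to `g`. -/
def MapsVec (T : L2 →ₗ.[ℂ] L2) (f g : L2) : Prop := ∃ h : f ∈ T.domain, T ⟨f, h⟩ = g

theorem MapsVec.smul {T : L2 →ₗ.[ℂ] L2} {f g : L2} (h : MapsVec T f g) (c : ℂ) :
    MapsVec (c • T) f (c • g) := by
  obtain ⟨h, rfl⟩ := h
  exact ⟨h, rfl⟩

theorem MapsVec.add {T S : L2 →ₗ.[ℂ] L2} {f g g' : L2} (h : MapsVec T f g) (h' : MapsVec S f g') :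
    MapsVec (T + S) f (g + g') := by
  obtain ⟨h, rfl⟩ := h
  obtain ⟨h', rfl⟩ := h'
  exact ⟨⟨h, h'⟩, rfl⟩

theorem MapsVec.shift {T : L2 →ₗ.[ℂ] L2} {f g : L2} (h : MapsVec T f g) (c : ℂ) :
    MapsVec ((c • (LinearMap.id : L2 →ₗ[ℂ] L2)) +ᵥ T) f (c • f + g) := by
  obtain ⟨h, rfl⟩ := h
  exact ⟨h, rfl⟩

theorem MapsVec.opMul {T S : L2 →ₗ.[ℂ] L2} {f g g' : L2} (h : MapsVec S f g)
    (h' : MapsVec T g g') : MapsVec (opMul T S) f g' := by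
  obtain ⟨h, rfl⟩ := h
  obtain ⟨h', rfl⟩ := h'
  exact ⟨⟨⟨f, h⟩, h', rfl⟩, rfl⟩

/-- The domain contains the Schwartz functions, hence is dense, so the formal identity determines
the value of the adjoint. -/
theorem mapsVec_adjoint {T : L2 →ₗ.[ℂ] L2} (hT : ∀ f : 𝓢(ℝ, ℂ), toL2 f ∈ T.domain) {v w : L2}
    (h : ∀ u (hu : u ∈ T.domain), inner ℂ w u = inner ℂ v (T ⟨u, hu⟩)) :
    MapsVec T.adjoint v w := by
  have hd : Dense (T.domain : Set L2) := denseRange_toL2.mono (by rintro _ ⟨f, rfl⟩; exact hT f)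
  exact ⟨LinearPMap.mem_adjoint_domain_of_exists _ ⟨w, fun x => h _ x.2⟩,
    LinearPMap.adjoint_apply_eq hd _ fun x => h _ x.2⟩

theorem dense_schwartzOp_domain (D : 𝓢(ℝ, ℂ) →ₗ[ℂ] 𝓢(ℝ, ℂ)) :
    Dense ((schwartzOp D).domain : Set L2) :=
  denseRange_toL2.mono (by rintro _ ⟨f, rfl⟩; exact mem_schwartzOp_domain D f)

theorem mapsVec_opc (f : 𝓢(ℝ, ℂ)) : MapsVec opc (toL2 f) (toL2 (lowering f)) := by
  refine mapsVec_adjoint (mem_schwartzOp_domain _) ?_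
  rintro _ ⟨g, rfl⟩
  exact (inner_lowering_left f g).trans (congrArg (inner ℂ (toL2 f)) (schwartzOp_apply raising g ⟨g, rfl⟩).symm)

theorem mapsVec_opcDag (f : 𝓢(ℝ, ℂ)) : MapsVec opcDag (toL2 f) (toL2 (raising f)) := by
  refine mapsVec_adjoint (mem_schwartzOp_domain _) ?_
  rintro _ ⟨g, rfl⟩
  exact (inner_raising_left f g).trans (congrArg (inner ℂ (toL2 f)) (schwartzOp_apply lowering g ⟨g, rfl⟩).symm)

/-- Here `u` ranges over the whole maximal domain; this is what later identifies adjoints of `A`,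
`B` and `N` on Schwartz functions. -/
theorem inner_opc (f : 𝓢(ℝ, ℂ)) (u : opc.domain) :
    inner ℂ (toL2 f) (opc u) = inner ℂ (toL2 (raising f)) (u : L2) := by
  have := LinearPMap.adjoint_isFormalAdjoint (dense_schwartzOp_domain raising) u
    ⟨toL2 f, mem_schwartzOp_domain _ f⟩
  rw [schwartzOp_apply] at this
  rw [← inner_conj_symm, ← inner_conj_symm (toL2 (raising f))]
  exact congrArg _ this

theorem inner_opcDag (f : 𝓢(ℝ, ℂ)) (u : opcDag.domain) :
    inner ℂ (toL2 f) (opcDag u) = inner ℂ (toL2 (lowering f)) (u : L2) := by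
  have := LinearPMap.adjoint_isFormalAdjoint (dense_schwartzOp_domain lowering) u
    ⟨toL2 f, mem_schwartzOp_domain _ f⟩
  rw [schwartzOp_apply] at this
  rw [← inner_conj_symm, ← inner_conj_symm (toL2 (lowering f))]
  exact congrArg _ this

/-! ### Ladder operators on Schwartz functions and their adjoints -/

/-- The action `cosh θ (d/dx + x)/√2 + sinh θ (-d/dx + x)/√2 + γ` on Schwartz functions. -/
def downS (θ γ : ℝ) : 𝓢(ℝ, ℂ) →ₗ[ℂ] 𝓢(ℝ, ℂ) :=
  ((Real.cosh θ : ℝ) : ℂ) • lowering + ((Real.sinh θ : ℝ) : ℂ) • raising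
    + (γ : ℂ) • LinearMap.id

/-- The action `cosh θ (-d/dx + x)/√2 + sinh θ (d/dx + x)/√2 + γ` on Schwartz functions. -/
def upS (θ γ : ℝ) : 𝓢(ℝ, ℂ) →ₗ[ℂ] 𝓢(ℝ, ℂ) :=
  ((Real.cosh θ : ℝ) : ℂ) • raising + ((Real.sinh θ : ℝ) : ℂ) • lowering
    + (γ : ℂ) • LinearMap.id

theorem downS_apply (θ γ : ℝ) (f : 𝓢(ℝ, ℂ)) (x : ℝ) :
    downS θ γ f x = thetaMinus θ * deriv f x + (thetaPlus θ * x + γ) * f x := by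
  simp only [downS, LinearMap.add_apply, LinearMap.smul_apply, LinearMap.id_apply,
    add_apply, smul_apply, smul_eq_mul, lowering_apply, raising_apply,
    thetaMinus, thetaPlus, ← Real.cosh_add_sinh, Real.cosh_neg, Real.sinh_neg]
  push_cast
  ring

theorem upS_apply (θ γ : ℝ) (f : 𝓢(ℝ, ℂ)) (x : ℝ) :
    upS θ γ f x = -thetaMinus θ * deriv f x + (thetaPlus θ * x + γ) * f x := by
  simp only [upS, LinearMap.add_apply, LinearMap.smul_apply, LinearMap.id_apply,
    add_apply, smul_apply, smul_eq_mul, lowering_apply, raising_apply,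
    thetaMinus, thetaPlus, ← Real.cosh_add_sinh, Real.cosh_neg, Real.sinh_neg]
  push_cast
  ring

theorem mapsVec_opA (θ α β : ℝ) (f : 𝓢(ℝ, ℂ)) :
    MapsVec (opA θ α β) (toL2 f) (toL2 (downS θ (gammaA θ α β) f)) := by
  have h : toL2 (downS θ (gammaA θ α β) f) =
      ((Real.cosh θ : ℝ) : ℂ) • ((α : ℂ) • toL2 f + toL2 (lowering f))
      + ((Real.sinh θ : ℝ) : ℂ) • ((β : ℂ) • toL2 f + toL2 (raising f)) := by
    simp only [downS, toL2, gammaA, LinearMap.add_apply, LinearMap.smul_apply, LinearMap.id_apply,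
      map_add, map_smul]
    push_cast
    module
  rw [h]
  exact (((mapsVec_opc f).shift α).smul ((Real.cosh θ : ℝ) : ℂ)).add
    (((mapsVec_opcDag f).shift β).smul ((Real.sinh θ : ℝ) : ℂ))

theorem mapsVec_opB (θ α β : ℝ) (f : 𝓢(ℝ, ℂ)) :
    MapsVec (opB θ α β) (toL2 f) (toL2 (upS θ (gammaB θ α β) f)) := by
  have h : toL2 (upS θ (gammaB θ α β) f) =
      ((Real.cosh θ : ℝ) : ℂ) • ((β : ℂ) • toL2 f + toL2 (raising f))
      + ((Real.sinh θ : ℝ) : ℂ) • ((α : ℂ) • toL2 f + toL2 (lowering f)) := by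
    simp only [upS, toL2, gammaB, LinearMap.add_apply, LinearMap.smul_apply, LinearMap.id_apply,
      map_add, map_smul]
    push_cast
    module
  rw [h]
  exact (((mapsVec_opcDag f).shift β).smul ((Real.cosh θ : ℝ) : ℂ)).add
    (((mapsVec_opc f).shift α).smul ((Real.sinh θ : ℝ) : ℂ))

theorem inner_opA (θ α β : ℝ) (f : 𝓢(ℝ, ℂ)) (u : (opA θ α β).domain) :
    inner ℂ (toL2 f) (opA θ α β u) = inner ℂ (toL2 (upS θ (gammaA θ α β) f)) (u : L2) := by
  have h : opA θ α β u = ((Real.cosh θ : ℝ) : ℂ) • ((α : ℂ) • (u : L2) + opc ⟨u, u.2.1⟩)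
      + ((Real.sinh θ : ℝ) : ℂ) • ((β : ℂ) • (u : L2) + opcDag ⟨u, u.2.2⟩) := rfl
  rw [h]
  simp only [upS, toL2, gammaA, LinearMap.add_apply, LinearMap.smul_apply, LinearMap.id_apply,
    map_add, map_smul, inner_add_left, inner_add_right, inner_smul_left, inner_smul_right,
    Complex.conj_ofReal]
  rw [inner_opc, inner_opcDag]
  push_cast
  ring

theorem inner_opB (θ α β : ℝ) (f : 𝓢(ℝ, ℂ)) (u : (opB θ α β).domain) :
    inner ℂ (toL2 f) (opB θ α β u) = inner ℂ (toL2 (downS θ (gammaB θ α β) f)) (u : L2) := by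
  have h : opB θ α β u = ((Real.cosh θ : ℝ) : ℂ) • ((β : ℂ) • (u : L2) + opcDag ⟨u, u.2.1⟩)
      + ((Real.sinh θ : ℝ) : ℂ) • ((α : ℂ) • (u : L2) + opc ⟨u, u.2.2⟩) := rfl
  rw [h]
  simp only [downS, toL2, gammaB, LinearMap.add_apply, LinearMap.smul_apply, LinearMap.id_apply,
    map_add, map_smul, inner_add_left, inner_add_right, inner_smul_left, inner_smul_right,
    Complex.conj_ofReal]
  rw [inner_opc, inner_opcDag]
  push_cast
  ring

theorem mapsVec_opA_adjoint (θ α β : ℝ) (f : 𝓢(ℝ, ℂ)) :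
    MapsVec (opA θ α β).adjoint (toL2 f) (toL2 (upS θ (gammaA θ α β) f)) :=
  mapsVec_adjoint (fun f => (mapsVec_opA θ α β f).1) fun u hu => (inner_opA θ α β f ⟨u, hu⟩).symm

theorem mapsVec_opB_adjoint (θ α β : ℝ) (f : 𝓢(ℝ, ℂ)) :
    MapsVec (opB θ α β).adjoint (toL2 f) (toL2 (downS θ (gammaB θ α β) f)) :=
  mapsVec_adjoint (fun f => (mapsVec_opB θ α β f).1) fun u hu => (inner_opB θ α β f ⟨u, hu⟩).symm

theorem mapsVec_opN (θ α β : ℝ) (f : 𝓢(ℝ, ℂ)) :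
    MapsVec (opN θ α β) (toL2 f)
      (toL2 (upS θ (gammaB θ α β) (downS θ (gammaA θ α β) f))) :=
  (mapsVec_opA θ α β f).opMul (mapsVec_opB θ α β _)

theorem mapsVec_opN_adjoint (θ α β : ℝ) (f : 𝓢(ℝ, ℂ)) :
    MapsVec (opN θ α β).adjoint (toL2 f)
      (toL2 (upS θ (gammaA θ α β) (downS θ (gammaB θ α β) f))) := by
  refine mapsVec_adjoint (fun f => (mapsVec_opN θ α β f).1) ?_
  rintro _ ⟨u, hu, rfl⟩
  -- Since `u ∈ D(A)` and `A u ∈ D(B)`, the two formal adjoint identities can be applied in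
  -- succession.
  exact (inner_opA θ α β _ u).symm.trans (inner_opB θ α β f ⟨_, hu⟩).symm

/-! ### Polynomials times Gaussians as Schwartz functions -/

open Polynomial in
/-- The function `x ↦ P(x) exp(-a x² - b x)`. -/
def polyGauss (P : ℝ[X]) (a b x : ℝ) : ℂ := ((P.eval x * Real.exp (-a * x ^ 2 - b * x) : ℝ) : ℂ)

open Polynomial in
theorem hasDerivAt_polyGauss (P : ℝ[X]) (a b x : ℝ) :
    HasDerivAt (polyGauss P a b) (polyGauss (derivative P - (C (2 * a) * X + C b) * P) a b x) x := by
  have h : HasDerivAt (fun x => P.eval x * Real.exp (-a * x ^ 2 - b * x))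
      ((derivative P - (C (2 * a) * X + C b) * P).eval x * Real.exp (-a * x ^ 2 - b * x)) x := by
    have h1 : HasDerivAt (fun x : ℝ => -a * x ^ 2 - b * x) (-a * (2 * x) - b) x := by
      simpa using ((hasDerivAt_pow 2 x).const_mul (-a)).fun_sub ((hasDerivAt_id x).const_mul b)
    refine ((P.hasDerivAt x).fun_mul h1.exp).congr_deriv ?_
    simp only [eval_sub, eval_mul, eval_add, eval_C, eval_X]
    ring
  exact h.ofReal_comp

open Polynomial in
theorem deriv_polyGauss (P : ℝ[X]) (a b : ℝ) :
    deriv (polyGauss P a b) = polyGauss (derivative P - (C (2 * a) * X + C b) * P) a b :=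
  funext fun x => (hasDerivAt_polyGauss P a b x).deriv

/-- Closure under differentiation reduces every Schwartz seminorm to a sup bound for one function of
the same shape. -/
theorem exists_iteratedDeriv_polyGauss (P : Polynomial ℝ) (a b : ℝ) (n : ℕ) :
    ∃ Q : Polynomial ℝ, iteratedDeriv n (polyGauss P a b) = polyGauss Q a b := by
  induction n with
  | zero => exact ⟨P, iteratedDeriv_zero⟩
  | succ n ih =>
    obtain ⟨Q, hQ⟩ := ih
    exact ⟨_, by rw [iteratedDeriv_succ, hQ, deriv_polyGauss]⟩

theorem contDiff_polyGauss (P : Polynomial ℝ) (a b : ℝ) : ContDiff ℝ ⊤ (polyGauss P a b) :=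
  by
  have h : ContDiff ℝ ⊤ fun x : ℝ => P.eval x * Real.exp (-a * x ^ 2 - b * x) := by
    have hP : ContDiff ℝ ⊤ fun x : ℝ => P.eval x := by
      simpa [Polynomial.coe_aeval_eq_eval] using P.contDiff_aeval (𝕜 := ℝ) ⊤
    exact hP.mul (by fun_prop)
  exact Complex.ofRealCLM.contDiff.comp h

theorem exists_abs_eval_le_exp_abs (P : Polynomial ℝ) :
    ∃ M, 0 ≤ M ∧ ∀ x : ℝ, |P.eval x| ≤ M * Real.exp |x| := by
  induction P using Polynomial.induction_on' with
  | add p q hp hq =>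
    obtain ⟨M, hM, h⟩ := hp
    obtain ⟨M', hM', h'⟩ := hq
    refine ⟨M + M', by positivity, fun x => ?_⟩
    rw [Polynomial.eval_add, add_mul]
    exact (abs_add_le _ _).trans (add_le_add (h x) (h' x))
  | monomial n c =>
    refine ⟨|c| * n.factorial, by positivity, fun x => ?_⟩
    rw [Polynomial.eval_monomial, abs_mul, abs_pow, mul_assoc]
    have := Real.pow_div_factorial_le_exp |x| (abs_nonneg x) n
    rw [div_le_iff₀ (by positivity)] at this
    gcongr
    linarith

theorem exists_norm_polyGauss_le (P : Polynomial ℝ) {a : ℝ} (ha : 0 < a) (b : ℝ) :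
    ∃ M, 0 ≤ M ∧ ∀ x, ‖polyGauss P a b x‖ ≤ M := by
  obtain ⟨M, hM, h⟩ := exists_abs_eval_le_exp_abs P
  -- The exponent is the maximum of `(1 + |b|) t - a t²` over `t`.
  refine ⟨M * Real.exp ((1 + |b|) ^ 2 / (4 * a)), by positivity, fun x => ?_⟩
  rw [polyGauss, Complex.norm_real, Real.norm_eq_abs, abs_mul, Real.abs_exp]
  calc |P.eval x| * Real.exp (-a * x ^ 2 - b * x)
      ≤ (M * Real.exp |x|) * Real.exp (-a * x ^ 2 - b * x) := by gcongr; exact h x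
    _ = M * Real.exp (|x| + (-a * x ^ 2 - b * x)) := by rw [mul_assoc, ← Real.exp_add]
    _ ≤ _ := by
      gcongr
      have h1 : -(b * x) ≤ |b| * |x| := by rw [← abs_mul]; exact neg_le_abs _
      have h2 : x ^ 2 = |x| ^ 2 := (sq_abs x).symm
      rw [le_div_iff₀ (by positivity), h2]
      nlinarith [sq_nonneg (2 * a * |x| - (1 + |b|))]

/-- The function `x ↦ P(x) exp(-a x² - b x)`, for `a > 0`, as a Schwartz function. -/
def polyGaussS (P : Polynomial ℝ) {a : ℝ} (ha : 0 < a) (b : ℝ) : 𝓢(ℝ, ℂ) where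
  toFun := polyGauss P a b
  smooth' := (contDiff_polyGauss P a b).of_le le_top
  decay' k n := by
    obtain ⟨Q, hQ⟩ := exists_iteratedDeriv_polyGauss P a b n
    obtain ⟨M, -, h⟩ := exists_norm_polyGauss_le (Polynomial.X ^ k * Q) ha b
    refine ⟨M, fun x => ?_⟩
    rw [norm_iteratedFDeriv_eq_norm_iteratedDeriv, hQ]
    refine le_trans (le_of_eq ?_) (h x)
    simp [polyGauss, mul_assoc]

@[simp] theorem polyGaussS_apply (P : Polynomial ℝ) {a : ℝ} (ha : 0 < a) (b x : ℝ) :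
    polyGaussS P ha b x = polyGauss P a b x := rfl

theorem polyGaussS_congr {P Q : Polynomial ℝ} (h : ∀ x, P.eval x = Q.eval x) {a : ℝ} (ha : 0 < a)
    (b : ℝ) : polyGaussS P ha b = polyGaussS Q ha b := by
  rw [Polynomial.funext h]

theorem smul_polyGaussS (r : ℝ) (P : Polynomial ℝ) {a : ℝ} (ha : 0 < a) (b : ℝ) :
    (r : ℂ) • polyGaussS P ha b = polyGaussS (Polynomial.C r * P) ha b := by
  ext x
  simp [polyGauss, mul_assoc]

/-! ### Hermite polynomials -/

open Polynomial in
theorem derivative_hermiteH_succ (n : ℕ) :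
    derivative (hermiteH (n + 1)) = C (2 * ((n : ℝ) + 1)) * hermiteH n := by
  induction n with
  | zero => simp [hermiteH]; rfl
  | succ n ih =>
    -- The induction hypothesis turns the defining recurrence into the three-term one, which is then
    -- differentiated.
    have h : hermiteH (n + 2) = 2 * X * hermiteH (n + 1) - C (2 * ((n : ℝ) + 1)) * hermiteH n := by
      rw [← ih]; rfl
    have h2 : derivative (2 * X : ℝ[X]) = 2 := by
      simp
    rw [h, derivative_sub, derivative_mul, h2, derivative_C_mul, ih]
    have h3 : hermiteH (n + 1) = 2 * X * hermiteH n - derivative (hermiteH n) := rfl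
    rw [h3]
    simp only [map_mul, map_add, map_natCast, map_one, map_ofNat, Nat.cast_add, Nat.cast_one]
    ring

theorem natDegree_hermiteH_and_coeff (n : ℕ) :
    (hermiteH n).natDegree ≤ n ∧ (hermiteH n).coeff n = 2 ^ n := by
  induction n with
  | zero => simp [hermiteH]
  | succ n ih =>
    have h2 : (2 : Polynomial ℝ) = Polynomial.C 2 := rfl
    have hd : (Polynomial.derivative (hermiteH n)).natDegree ≤ n :=
      (Polynomial.natDegree_derivative_le _).trans (by omega)
    constructor
    · refine (Polynomial.natDegree_sub_le _ _).trans (max_le ?_ (by omega))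
      refine (Polynomial.natDegree_mul_le).trans ?_
      have : (2 * Polynomial.X : Polynomial ℝ).natDegree ≤ 1 := by
        rw [h2]; exact Polynomial.natDegree_C_mul_le _ _ |>.trans Polynomial.natDegree_X_le
      omega
    · rw [hermiteH, Polynomial.coeff_sub, mul_assoc, h2, Polynomial.coeff_C_mul,
        Polynomial.coeff_X_mul, ih.2, Polynomial.coeff_eq_zero_of_natDegree_lt (by omega)]
      ring

theorem thetaMinus_pos (θ : ℝ) : 0 < thetaMinus θ := by unfold thetaMinus; positivity

theorem thetaPlus_pos (θ : ℝ) : 0 < thetaPlus θ := by unfold thetaPlus; positivity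

theorem two_mul_thetaPlus_mul_thetaMinus (θ : ℝ) : 2 * thetaPlus θ * thetaMinus θ = 1 := by
  have h : Real.exp θ * Real.exp (-θ) = 1 := by rw [← Real.exp_add]; simp
  have h2 : √2 * √2 = 2 := Real.mul_self_sqrt (by norm_num)
  unfold thetaPlus thetaMinus
  field_simp
  rw [pow_two, h2]
  linarith

theorem gaussCoeff_pos (θ : ℝ) : 0 < thetaPlus θ / (2 * thetaMinus θ) :=
  div_pos (thetaPlus_pos θ) (mul_pos two_pos (thetaMinus_pos θ))

open Polynomial in
/-- The polynomial factor of `hermiteGauss`. -/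
def hermitePoly (θ k c : ℝ) (n : ℕ) : ℝ[X] :=
  C (c / √(2 ^ n * (n.factorial : ℝ)))
    * (hermiteH n).comp (C (√2 * thetaMinus θ)⁻¹ * (X + C k))

/-- `hermiteGauss` as a Schwartz function. -/
def hermiteGaussS (θ k γ c : ℝ) (n : ℕ) : 𝓢(ℝ, ℂ) :=
  polyGaussS (hermitePoly θ k c n) (gaussCoeff_pos θ) (γ / thetaMinus θ)

theorem polyGauss_hermitePoly (θ k γ c : ℝ) (n : ℕ) :
    polyGauss (hermitePoly θ k c n) (thetaPlus θ / (2 * thetaMinus θ)) (γ / thetaMinus θ)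
      = hermiteGauss θ k γ c n := by
  ext x
  simp [polyGauss, hermitePoly, hermiteGauss, div_eq_mul_inv, mul_comm]

theorem coe_hermiteGaussS (θ k γ c : ℝ) (n : ℕ) :
    ⇑(hermiteGaussS θ k γ c n) = hermiteGauss θ k γ c n := polyGauss_hermitePoly θ k γ c n

theorem memLp_hermiteGauss (θ k γ c : ℝ) (n : ℕ) : MemLp (hermiteGauss θ k γ c n) 2 volume := by
  rw [← coe_hermiteGaussS]
  exact SchwartzMap.memLp _ 2 volume

theorem toLp_hermiteGauss {θ k γ c : ℝ} {n : ℕ} (h : MemLp (hermiteGauss θ k γ c n) 2 volume) :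
    h.toLp = toL2 (hermiteGaussS θ k γ c n) :=
  MemLp.toLp_congr h (SchwartzMap.memLp (hermiteGaussS θ k γ c n) 2 volume)
    (by rw [coe_hermiteGaussS])

/-! ### Ladder relations for the Hermite-Gauss functions -/

theorem downS_polyGaussS (θ γ γ' : ℝ) (P : Polynomial ℝ) :
    downS θ γ (polyGaussS P (gaussCoeff_pos θ) (γ' / thetaMinus θ))
      = polyGaussS (Polynomial.C (thetaMinus θ) * Polynomial.derivative P
          + Polynomial.C (γ - γ') * P) (gaussCoeff_pos θ) (γ' / thetaMinus θ) := by
  ext x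
  have h := (thetaMinus_pos θ).ne'
  have hd : deriv (polyGaussS P (gaussCoeff_pos θ) (γ' / thetaMinus θ)) x = _ :=
    congrFun (deriv_polyGauss P _ (γ' / thetaMinus θ)) x
  rw [downS_apply, hd]
  simp only [polyGaussS_apply, polyGauss, Polynomial.eval_add, Polynomial.eval_mul,
    Polynomial.eval_sub, Polynomial.eval_C, Polynomial.eval_X]
  norm_cast
  field_simp
  ring

theorem upS_polyGaussS (θ γ γ' : ℝ) (P : Polynomial ℝ) :
    upS θ γ (polyGaussS P (gaussCoeff_pos θ) (γ' / thetaMinus θ))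
      = polyGaussS (-Polynomial.C (thetaMinus θ) * Polynomial.derivative P
          + (Polynomial.C (2 * thetaPlus θ) * Polynomial.X + Polynomial.C (γ + γ')) * P)
          (gaussCoeff_pos θ) (γ' / thetaMinus θ) := by
  ext x
  have h := (thetaMinus_pos θ).ne'
  have hd : deriv (polyGaussS P (gaussCoeff_pos θ) (γ' / thetaMinus θ)) x = _ :=
    congrFun (deriv_polyGauss P _ (γ' / thetaMinus θ)) x
  rw [upS_apply, hd]
  simp only [polyGaussS_apply, polyGauss, Polynomial.eval_add, Polynomial.eval_mul,
    Polynomial.eval_sub, Polynomial.eval_C, Polynomial.eval_X, Polynomial.eval_neg]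
  norm_cast
  field_simp
  ring

open Polynomial in
theorem derivative_hermitePoly (θ k c : ℝ) (n : ℕ) :
    derivative (hermitePoly θ k c n) = C (c / √(2 ^ n * (n.factorial : ℝ)) * (√2 * thetaMinus θ)⁻¹)
      * (derivative (hermiteH n)).comp (C (√2 * thetaMinus θ)⁻¹ * (X + C k)) := by
  rw [hermitePoly, derivative_C_mul, derivative_comp]
  simp only [derivative_C_mul, derivative_add, derivative_X, derivative_C, add_zero, mul_one, C_mul]
  ring

theorem sqrt_two_pow_mul_factorial_succ (n : ℕ) :
    √(2 ^ (n + 1) * ((n + 1).factorial : ℝ))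
      = √2 * √((n : ℝ) + 1) * √(2 ^ n * (n.factorial : ℝ)) := by
  rw [← Real.sqrt_mul (by norm_num), ← Real.sqrt_mul (by positivity)]
  congr 1
  rw [Nat.factorial_succ]
  push_cast
  ring

theorem downS_hermiteGaussS_zero (θ k γ c : ℝ) : downS θ γ (hermiteGaussS θ k γ c 0) = 0 := by
  rw [hermiteGaussS, downS_polyGaussS, derivative_hermitePoly]
  ext x
  simp [polyGauss, hermiteH]

theorem downS_hermiteGaussS_succ (θ k γ c : ℝ) (n : ℕ) :
    downS θ γ (hermiteGaussS θ k γ c (n + 1))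
      = ((√((n : ℝ) + 1) : ℝ) : ℂ) • hermiteGaussS θ k γ c n := by
  rw [hermiteGaussS, downS_polyGaussS, derivative_hermitePoly, derivative_hermiteH_succ]
  rw [hermiteGaussS, smul_polyGaussS]
  refine polyGaussS_congr (fun x => ?_) _ _
  have h1 : √((n : ℝ) + 1) * √((n : ℝ) + 1) = n + 1 := Real.mul_self_sqrt (by positivity)
  have h2 : √2 * √2 = 2 := Real.mul_self_sqrt (by norm_num)
  have h3 : √((n : ℝ) + 1) ≠ 0 := by positivity
  have h4 : √(2 ^ n * (n.factorial : ℝ)) ≠ 0 := by positivity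
  have := (thetaMinus_pos θ).ne'
  simp only [hermitePoly, sub_self, map_zero, zero_mul, add_zero, Polynomial.eval_mul,
    Polynomial.eval_C, Polynomial.mul_comp, Polynomial.C_comp, sqrt_two_pow_mul_factorial_succ]
  field_simp
  rw [pow_two, pow_two, h1, h2]
  ring

/-- By `h` and `2 Θ₊ Θ₋ = 1` the linear factor is `(x + k) / Θ₋ = √2 y`, with `y` the Hermite
argument. The polynomial part becomes `(2 y Hₙ - Hₙ') / √2`, the defining recurrence. -/
theorem upS_hermiteGaussS (θ k γ γ' c : ℝ) (h : γ + γ' = k / thetaMinus θ) (n : ℕ) :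
    upS θ γ (hermiteGaussS θ k γ' c n)
      = ((√((n : ℝ) + 1) : ℝ) : ℂ) • hermiteGaussS θ k γ' c (n + 1) := by
  rw [hermiteGaussS, upS_polyGaussS, derivative_hermitePoly, h]
  rw [hermiteGaussS, smul_polyGaussS]
  refine polyGaussS_congr (fun x => ?_) _ _
  have h2 : √2 * √2 = 2 := Real.mul_self_sqrt (by norm_num)
  have h3 : √((n : ℝ) + 1) ≠ 0 := by positivity
  have h4 : √(2 ^ n * (n.factorial : ℝ)) ≠ 0 := by positivity
  have h5 := (thetaMinus_pos θ).ne'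
  have h6 : thetaPlus θ = 1 / (2 * thetaMinus θ) := by
    rw [eq_div_iff (by positivity)]
    linarith [two_mul_thetaPlus_mul_thetaMinus θ]
  simp only [hermitePoly, Polynomial.eval_mul, hermiteH, Polynomial.sub_comp, Polynomial.eval_sub,
    Polynomial.eval_add, Polynomial.eval_neg, Polynomial.ofNat_comp, Polynomial.X_comp,
    Polynomial.eval_X, Polynomial.eval_C, Polynomial.mul_comp, sqrt_two_pow_mul_factorial_succ,
    Polynomial.eval_ofNat, Nat.cast_ofNat, h6]
  generalize Polynomial.eval x ((hermiteH n).comp _) = u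
  generalize Polynomial.eval x ((Polynomial.derivative (hermiteH n)).comp _) = v
  field_simp
  linear_combination c * (x + k) * u * h2

theorem gammaA_add_gammaB (θ α β : ℝ) :
    gammaA θ α β + gammaB θ α β = shiftK α β / thetaMinus θ := by
  have h : Real.exp θ * Real.exp (-θ) = 1 := by rw [← Real.exp_add]; simp
  have h1 : gammaA θ α β + gammaB θ α β = (α + β) * Real.exp θ := by
    rw [← Real.cosh_add_sinh, gammaA, gammaB]; ring
  rw [h1, shiftK, thetaMinus]
  field_simp
  linear_combination (α + β) * h

theorem gammaA_sub_gammaB (θ α β : ℝ) :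
    gammaA θ α β - gammaB θ α β = (α - β) * Real.exp (-θ) := by
  rw [← Real.cosh_sub_sinh, gammaA, gammaB]; ring

theorem upS_downS_hermiteGaussS (θ k γ γ' c : ℝ) (h : γ' + γ = k / thetaMinus θ) (n : ℕ) :
    upS θ γ' (downS θ γ (hermiteGaussS θ k γ c n)) = (n : ℂ) • hermiteGaussS θ k γ c n := by
  cases n with
  | zero => simp [downS_hermiteGaussS_zero]
  | succ n =>
    rw [downS_hermiteGaussS_succ, map_smul, upS_hermiteGaussS θ k γ' γ c h, smul_smul]
    congr 1
    norm_cast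
    rw [Real.mul_self_sqrt (by positivity)]

/-! ### Completeness -/

-- A test function is the Fourier transform of a Schwartz function; moving that transform onto `g`
-- kills the integral.
open FourierTransform in
theorem ae_eq_zero_of_fourier_eq_zero {g : ℝ → ℂ} (hg : Integrable g) (h : ∀ w, 𝓕 g w = 0) :
    g =ᵐ[volume] 0 := by
  refine ae_eq_zero_of_integral_contDiff_smul_eq_zero hg.locallyIntegrable fun u hu hc => ?_
  have hc' : HasCompactSupport (Complex.ofRealCLM ∘ u) := hc.comp_left rfl
  have hu' : ContDiff ℝ ((⊤ : ℕ∞) : WithTop ℕ∞) (Complex.ofRealCLM ∘ u) := by fun_prop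
  let s : 𝓢(ℝ, ℂ) := hc'.toSchwartzMap hu'
  have key := VectorFourier.integral_fourierIntegral_smul_eq_flip (L := innerₗ ℝ) (μ := volume)
    (ν := volume) Real.continuous_fourierChar continuous_inner hg (𝓕⁻ s).integrable
  have h1 : ∀ x, VectorFourier.fourierIntegral Real.fourierChar volume (innerₗ ℝ).flip
      ((𝓕⁻ s : 𝓢(ℝ, ℂ)) : ℝ → ℂ) x = (u x : ℂ) := by
    intro x
    have : (𝓕 (𝓕⁻ s : 𝓢(ℝ, ℂ)) : 𝓢(ℝ, ℂ)) x = s x := by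
      rw [FourierInvPair.fourier_fourierInv_eq]
    rw [SchwartzMap.fourier_coe] at this
    rw [flip_innerₗ]
    exact this
  have h2 : ∀ w, VectorFourier.fourierIntegral Real.fourierChar volume (innerₗ ℝ) g w = 0 := h
  simp only [h1, h2, zero_smul, integral_zero] at key
  rw [key]
  exact integral_congr_ae (ae_of_all _ fun x => by simp [mul_comm])

/-- Expand the exponential and integrate termwise; the partial sums are dominated by `exp(‖c‖ |x|)
‖g x‖`. -/
theorem integral_cexp_mul_eq_zero {g : ℝ → ℂ} (hg : Integrable g)
    (hexp : ∀ t : ℝ, 0 ≤ t → Integrable fun x => Real.exp (t * |x|) * ‖g x‖)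
    (h : ∀ n : ℕ, ∫ x : ℝ, (x : ℂ) ^ n * g x = 0) (c : ℂ) :
    ∫ x : ℝ, Complex.exp (c * x) * g x = 0 := by
  have hs : ∀ x : ℝ, HasSum (fun n : ℕ => (‖c‖ * |x|) ^ n / (n.factorial : ℝ) * ‖g x‖)
      (Real.exp (‖c‖ * |x|) * ‖g x‖) := fun x => by
    rw [Real.exp_eq_exp_ℝ]
    exact (NormedSpace.expSeries_div_hasSum_exp (‖c‖ * |x|)).mul_right ‖g x‖
  have hlim : ∀ x : ℝ, HasSum (fun n : ℕ => (c * x) ^ n / (n.factorial : ℂ) * g x)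
      (Complex.exp (c * x) * g x) := fun x => by
    rw [Complex.exp_eq_exp_ℂ]
    exact (NormedSpace.expSeries_div_hasSum_exp (c * (x : ℂ))).mul_right (g x)
  have hm : ∀ n : ℕ, AEStronglyMeasurable
      (fun x : ℝ => (c * x) ^ n / (n.factorial : ℂ) * g x) volume := fun n => by
    have hc : Continuous fun x : ℝ => (c * x) ^ n / (n.factorial : ℂ) := by fun_prop
    exact hc.aestronglyMeasurable.mul hg.aestronglyMeasurable
  have hb : ∀ (n : ℕ) (x : ℝ), ‖(c * x) ^ n / (n.factorial : ℂ) * g x‖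
      ≤ (‖c‖ * |x|) ^ n / (n.factorial : ℝ) * ‖g x‖ := fun n x => by
    simp
  have hi : Integrable fun x => ∑' n : ℕ, (‖c‖ * |x|) ^ n / (n.factorial : ℝ) * ‖g x‖ := by
    simp_rw [fun x => (hs x).tsum_eq]
    exact hexp _ (norm_nonneg c)
  have hsum := hasSum_integral_of_dominated_convergence _ hm (fun n => ae_of_all _ (hb n))
    (ae_of_all _ fun x => (hs x).summable) hi (ae_of_all _ hlim)
  rw [← hsum.tsum_eq]
  refine (tsum_congr fun n => ?_).trans tsum_zero
  have : ∀ x : ℝ, (c * x) ^ n / (n.factorial : ℂ) * g x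
      = (c ^ n / (n.factorial : ℂ)) * ((x : ℂ) ^ n * g x) := fun x => by ring
  simp_rw [this]
  rw [integral_const_mul, h, mul_zero]

theorem ae_eq_zero_of_integral_pow_mul_eq_zero {g : ℝ → ℂ} (hg : Integrable g)
    (hexp : ∀ t : ℝ, 0 ≤ t → Integrable fun x => Real.exp (t * |x|) * ‖g x‖)
    (h : ∀ n : ℕ, ∫ x : ℝ, (x : ℂ) ^ n * g x = 0) : g =ᵐ[volume] 0 := by
  refine ae_eq_zero_of_fourier_eq_zero hg fun w => ?_
  rw [Real.fourier_real_eq_integral_exp_smul,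
    ← integral_cexp_mul_eq_zero hg hexp h (((-2 * Real.pi * w : ℝ) : ℂ) * Complex.I)]
  refine integral_congr_ae (ae_of_all _ fun x => ?_)
  simp only [smul_eq_mul]
  congr 2
  push_cast
  ring

theorem integrable_polyGauss_mul (P : Polynomial ℝ) {a : ℝ} (ha : 0 < a) (b : ℝ) {f : ℝ → ℂ}
    (hf : MemLp f 2 volume) : Integrable fun x => polyGauss P a b x * f x :=
  MemLp.integrable_mul (p := 2) (q := 2) ((polyGaussS P ha b).memLp 2 volume) hf

theorem ae_eq_zero_of_integral_polyGauss_mul_eq_zero {a : ℝ} (ha : 0 < a) (b : ℝ) {f : ℝ → ℂ}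
    (hf : MemLp f 2 volume) (h : ∀ P : Polynomial ℝ, ∫ x, polyGauss P a b x * f x = 0) :
    f =ᵐ[volume] 0 := by
  have h0 : (fun x => polyGauss 1 a b x * f x) =ᵐ[volume] 0 := by
    refine ae_eq_zero_of_integral_pow_mul_eq_zero (integrable_polyGauss_mul 1 ha b hf)
      (fun t ht => ?_) fun n => ?_
    -- `exp(t|x|) ≤ exp(t x) + exp(-t x)`, and each exponential is absorbed by changing `b` to `b ∓
    -- t`.
    · refine Integrable.mono' ((integrable_polyGauss_mul 1 ha (b - t) hf).norm.add
        (integrable_polyGauss_mul 1 ha (b + t) hf).norm)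
        ((Continuous.aestronglyMeasurable (by fun_prop)).mul
          (integrable_polyGauss_mul 1 ha b hf).aestronglyMeasurable.norm)
        (ae_of_all _ fun x => ?_)
      have e : ∀ c, ‖polyGauss 1 a c x‖ = Real.exp (-a * x ^ 2 - c * x) := fun c => by
        rw [polyGauss, Complex.norm_real]
        simp
      simp only [Pi.add_apply, norm_mul, e, ← add_mul, Real.norm_eq_abs, abs_norm, Real.abs_exp,
        ← mul_assoc, ← Real.exp_add]
      gcongr
      rcases abs_cases x with ⟨hx, -⟩ | ⟨hx, -⟩
      · rw [hx, show t * x + (-a * x ^ 2 - b * x) = -a * x ^ 2 - (b - t) * x by ring]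
        exact le_add_of_nonneg_right (Real.exp_pos _).le
      · rw [hx, show t * -x + (-a * x ^ 2 - b * x) = -a * x ^ 2 - (b + t) * x by ring]
        exact le_add_of_nonneg_left (Real.exp_pos _).le
    · rw [← h (Polynomial.X ^ n)]
      exact integral_congr_ae (ae_of_all _ fun x => by simp [polyGauss, mul_assoc])
  filter_upwards [h0] with x hx
  refine (mul_eq_zero.mp hx).resolve_left ?_
  simp [polyGauss]

theorem degree_hermitePoly (θ k : ℝ) {c : ℝ} (hc : c ≠ 0) (n : ℕ) :
    (hermitePoly θ k c n).degree = n := by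
  have h1 : (hermiteH n).natDegree = n :=
    Polynomial.natDegree_eq_of_le_of_coeff_ne_zero (natDegree_hermiteH_and_coeff n).1
      (by rw [(natDegree_hermiteH_and_coeff n).2]; positivity)
  have h2 : (√2 * thetaMinus θ)⁻¹ ≠ 0 := by
    have := thetaMinus_pos θ
    positivity
  have h3 : c / √(2 ^ n * (n.factorial : ℝ)) ≠ 0 := div_ne_zero hc (by positivity)
  have h4 : (Polynomial.C (√2 * thetaMinus θ)⁻¹ * (Polynomial.X + Polynomial.C k)).natDegree = 1 := by
    rw [Polynomial.natDegree_C_mul h2, Polynomial.natDegree_X_add_C]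
  have h5 : (hermiteH n).comp (Polynomial.C (√2 * thetaMinus θ)⁻¹ * (Polynomial.X + Polynomial.C k))
      ≠ 0 := by
    intro h0
    rw [Polynomial.comp_eq_zero_iff] at h0
    rcases h0 with h0 | ⟨-, h0⟩
    · have := (natDegree_hermiteH_and_coeff n).2
      rw [h0, Polynomial.coeff_zero] at this
      exact (pow_ne_zero n two_ne_zero) this.symm
    · rw [h0, Polynomial.natDegree_C] at h4
      exact zero_ne_one h4
  rw [hermitePoly, Polynomial.degree_C_mul h3, Polynomial.degree_eq_natDegree h5,
    Polynomial.natDegree_comp, h4, h1, mul_one]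

theorem span_hermitePoly (θ k : ℝ) {c : ℝ} (hc : c ≠ 0) :
    Submodule.span ℝ (Set.range (hermitePoly θ k c)) = ⊤ := by
  let S : Polynomial.Sequence ℝ := ⟨hermitePoly θ k c, degree_hermitePoly θ k hc⟩
  exact S.span fun i => (Polynomial.leadingCoeff_ne_zero.mpr (S.ne_zero i)).isUnit

theorem polyGauss_add (P Q : Polynomial ℝ) (a b x : ℝ) :
    polyGauss (P + Q) a b x = polyGauss P a b x + polyGauss Q a b x := by
  simp [polyGauss, add_mul]

theorem isCompleteFamily_hermiteGaussS (θ k γ : ℝ) {c : ℝ} (hc : c ≠ 0) :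
    IsCompleteFamily fun n => toL2 (hermiteGaussS θ k γ c n) := by
  rw [IsCompleteFamily, Submodule.dense_iff_topologicalClosure_eq_top,
    Submodule.topologicalClosure_eq_top_iff, Submodule.eq_bot_iff]
  intro f hf
  rw [Submodule.mem_orthogonal] at hf
  rw [Lp.eq_zero_iff_ae_eq_zero]
  refine ae_eq_zero_of_integral_polyGauss_mul_eq_zero (gaussCoeff_pos θ) (γ / thetaMinus θ)
    (Lp.memLp f) fun P => ?_
  have hP : P ∈ Submodule.span ℝ (Set.range (hermitePoly θ k c)) := by
    rw [span_hermitePoly θ k hc]; trivial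
  -- Orthogonality passes from the Hermite polynomials, one in each degree, to all polynomials.
  induction hP using Submodule.span_induction with
  | mem P hP =>
    obtain ⟨n, rfl⟩ := hP
    rw [polyGauss_hermitePoly]
    have := hf _ (Submodule.subset_span ⟨n, rfl⟩)
    rw [L2.inner_def] at this
    rw [← this]
    refine integral_congr_ae ?_
    filter_upwards [coeFn_toL2 (hermiteGaussS θ k γ c n)] with x hx
    rw [hx, coe_hermiteGaussS]
    rw [RCLike.inner_apply, hermiteGauss, Complex.conj_ofReal, mul_comm]
  | zero => simp [polyGauss]
  | add P Q _ _ hP hQ =>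
    simp only [polyGauss_add, add_mul]
    rw [integral_add (integrable_polyGauss_mul P (gaussCoeff_pos θ) _ (Lp.memLp f))
      (integrable_polyGauss_mul Q (gaussCoeff_pos θ) _ (Lp.memLp f)), hP, hQ, add_zero]
  | smul r P _ hP =>
    have : ∀ b x, polyGauss (r • P) (thetaPlus θ / (2 * thetaMinus θ)) b x
        = r * polyGauss P (thetaPlus θ / (2 * thetaMinus θ)) b x := fun b x => by
      simp [polyGauss, mul_assoc]
    simp only [this, mul_assoc]
    rw [integral_const_mul, hP, mul_zero]

/-! ### Gaussian integrals of Hermite polynomials -/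

/-- The integral of a polynomial against `exp(-y²)`. -/
def gaussInt (P : Polynomial ℝ) : ℝ := ∫ y : ℝ, P.eval y * Real.exp (-y ^ 2)

theorem integrable_eval_mul_exp_neg_sq (P : Polynomial ℝ) :
    Integrable fun y : ℝ => P.eval y * Real.exp (-y ^ 2) := by
  have := (polyGaussS P one_pos 0).integrable (μ := volume)
  refine this.re.congr (ae_of_all _ fun x => ?_)
  simp [polyGauss, -Complex.ofReal_mul, -Complex.ofReal_exp]

theorem gaussInt_add (P Q : Polynomial ℝ) : gaussInt (P + Q) = gaussInt P + gaussInt Q := by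
  simp only [gaussInt, Polynomial.eval_add, add_mul]
  exact integral_add (integrable_eval_mul_exp_neg_sq P) (integrable_eval_mul_exp_neg_sq Q)

theorem gaussInt_C_mul (r : ℝ) (P : Polynomial ℝ) :
    gaussInt (Polynomial.C r * P) = r * gaussInt P := by
  simp only [gaussInt, Polynomial.eval_mul, Polynomial.eval_C, mul_assoc]
  exact integral_const_mul _ _

/-- `gaussInt` as a linear form. -/
def gaussIntₗ : Polynomial ℝ →ₗ[ℝ] ℝ where
  toFun := gaussInt
  map_add' := gaussInt_add
  map_smul' r P := by rw [Polynomial.smul_eq_C_mul, gaussInt_C_mul]; rfl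

theorem gaussInt_sum {ι : Type*} (s : Finset ι) (P : ι → Polynomial ℝ) :
    gaussInt (∑ i ∈ s, P i) = ∑ i ∈ s, gaussInt (P i) := map_sum gaussIntₗ P s

theorem gaussInt_one : gaussInt 1 = √Real.pi := by
  simpa [gaussInt] using integral_gaussian 1

open Polynomial in
theorem gaussInt_two_X_mul (P : ℝ[X]) : gaussInt (2 * X * P) = gaussInt (derivative P) := by
  have hd : ∀ y : ℝ, HasDerivAt (fun y : ℝ => P.eval y * Real.exp (-y ^ 2))
      ((derivative P + C (-1) * (2 * X * P)).eval y * Real.exp (-y ^ 2)) y := fun y => by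
    have h1 : HasDerivAt (fun y : ℝ => -y ^ 2) (-(2 * y)) y := by
      simpa using (hasDerivAt_pow 2 y).fun_neg
    refine ((P.hasDerivAt y).fun_mul h1.exp).congr_deriv ?_
    simp only [eval_mul, eval_add, eval_C, eval_X, eval_ofNat]
    ring
  have h : gaussInt (derivative P + C (-1) * (2 * X * P)) = 0 :=
    integral_eq_zero_of_hasDerivAt_of_integrable hd (integrable_eval_mul_exp_neg_sq _)
      (integrable_eval_mul_exp_neg_sq _)
  rw [gaussInt_add, gaussInt_C_mul] at h
  linarith

-- Under the weight `exp(-y²)`, the raising map `P ↦ 2 X P - P'` is the adjoint of differentiation.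
open Polynomial in
theorem gaussInt_hermiteH_succ_mul (n : ℕ) (Q : ℝ[X]) :
    gaussInt (hermiteH (n + 1) * Q) = gaussInt (hermiteH n * derivative Q) := by
  have h : hermiteH (n + 1) * Q
      = 2 * X * (hermiteH n * Q) + C (-1) * (derivative (hermiteH n) * Q) := by
    simp only [hermiteH, map_neg, map_one]
    ring
  rw [h, gaussInt_add, gaussInt_two_X_mul, derivative_mul, gaussInt_add, gaussInt_C_mul]
  ring

theorem gaussInt_hermiteH_mul_hermiteH (n m : ℕ) :
    gaussInt (hermiteH n * hermiteH m)
      = if n = m then 2 ^ n * (n.factorial : ℝ) * √Real.pi else 0 := by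
  induction n generalizing m with
  | zero =>
    cases m with
    | zero => simp [hermiteH, gaussInt_one]
    | succ m =>
      rw [mul_comm, gaussInt_hermiteH_succ_mul]
      simp [hermiteH, gaussInt]
  | succ n ih =>
    rw [gaussInt_hermiteH_succ_mul]
    cases m with
    | zero => simp [hermiteH, gaussInt]
    | succ m =>
      rw [derivative_hermiteH_succ, mul_left_comm, gaussInt_C_mul, ih]
      by_cases h : n = m
      · subst h
        simp only [if_true, Nat.factorial_succ]
        push_cast
        ring
      · simp [h]

open Polynomial in
/-- The operator `P ↦ 2 X P - P'` on polynomials. -/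
def hermiteRaise : Module.End ℝ ℝ[X] := LinearMap.mulLeft ℝ (2 * X) - derivative

theorem hermiteH_eq_pow (n : ℕ) : hermiteH n = (hermiteRaise ^ n) 1 := by
  induction n with
  | zero => rfl
  | succ n ih =>
    rw [pow_succ', Module.End.mul_apply, ← ih]
    rfl

-- Translation by `s` fixes `1` and conjugates the raising map into itself plus the scalar `2 s`.
open Polynomial in
theorem hermiteH_comp_X_add_C_eq_pow (n : ℕ) (s : ℝ) :
    (hermiteH n).comp (X + C s) = ((hermiteRaise + algebraMap ℝ (Module.End ℝ ℝ[X]) (2 * s)) ^ n) 1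
    := by
  induction n with
  | zero => simp [hermiteH]
  | succ n ih =>
    rw [pow_succ', Module.End.mul_apply, ← ih, LinearMap.add_apply, Module.algebraMap_end_apply]
    have h : derivative ((hermiteH n).comp (X + C s)) = (derivative (hermiteH n)).comp (X + C s) := by
      rw [derivative_comp]; simp
    simp only [hermiteH, hermiteRaise, LinearMap.sub_apply, LinearMap.mulLeft_apply, h, sub_comp,
      mul_comp, X_comp, smul_eq_C_mul, C_mul]
    have h2 : (2 : ℝ[X]).comp (X + C s) = 2 := by simp
    have h3 : (C 2 : ℝ[X]) = 2 := rfl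
    rw [h2, h3]
    ring

-- The scalar commutes with the raising map, so this is the binomial theorem for operators.
open Polynomial in
theorem hermiteH_comp_X_add_C (n : ℕ) (s : ℝ) :
    (hermiteH n).comp (X + C s) =
      ∑ j ∈ Finset.range (n + 1), C ((n.choose j : ℝ) * (2 * s) ^ (n - j)) * hermiteH j := by
  rw [hermiteH_comp_X_add_C_eq_pow,
    (Algebra.commute_algebraMap_right (2 * s) hermiteRaise).add_pow, LinearMap.sum_apply]
  refine Finset.sum_congr rfl fun j _ => ?_
  rw [← map_pow, ← map_natCast (algebraMap ℝ (Module.End ℝ ℝ[X])), mul_assoc, ← map_mul,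
    Module.End.mul_apply, Module.algebraMap_end_apply, map_smul, ← hermiteH_eq_pow, smul_eq_C_mul,
    mul_comm (n.choose j : ℝ)]

open Polynomial in
theorem gaussInt_hermiteH_comp_sq (n : ℕ) (s : ℝ) :
    gaussInt ((hermiteH n).comp (X + C s) * (hermiteH n).comp (X + C s))
      = 2 ^ n * (n.factorial : ℝ) * √Real.pi * laguerreL n (-(2 * s ^ 2)) := by
  -- Only diagonal terms will survive; `Finset.sum_flip` reverses the order so that `(2 s) ^ (n -
  -- j)` lines up with the `j`-th Laguerre term.
  rw [hermiteH_comp_X_add_C, Finset.sum_mul_sum, gaussInt_sum, laguerreL, Finset.mul_sum,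
    ← Finset.sum_flip]
  refine Finset.sum_congr rfl fun j hj => ?_
  have hj' : j ≤ n := Nat.lt_succ_iff.mp (Finset.mem_range.mp hj)
  rw [gaussInt_sum]
  have : ∀ i, gaussInt (C ((n.choose (n - j) : ℝ) * (2 * s) ^ (n - (n - j))) * hermiteH (n - j)
      * (C ((n.choose i : ℝ) * (2 * s) ^ (n - i)) * hermiteH i))
      = ((n.choose (n - j) : ℝ) * (2 * s) ^ (n - (n - j))) * ((n.choose i : ℝ) * (2 * s) ^ (n - i))
        * (if n - j = i then 2 ^ (n - j) * ((n - j).factorial : ℝ) * √Real.pi else 0) := fun i => by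
    rw [mul_mul_mul_comm, ← C_mul, gaussInt_C_mul, gaussInt_hermiteH_mul_hermiteH]
  simp_rw [this]
  rw [Finset.sum_eq_single (n - j) (fun i _ hi => by rw [if_neg (Ne.symm hi), mul_zero])
    (fun h => absurd (Finset.mem_range.mpr (by omega)) h), if_pos rfl, Nat.sub_sub_self hj',
    Nat.choose_symm hj']
  have hf : (n.factorial : ℝ) = n.choose j * j.factorial * (n - j).factorial := by
    exact_mod_cast (Nat.choose_mul_factorial_mul_factorial hj').symm
  have h2 : (2 : ℝ) ^ n = 2 ^ j * 2 ^ (n - j) := by rw [← pow_add]; congr 1; omega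
  rw [hf, h2, neg_neg]
  have : (j.factorial : ℝ) ≠ 0 := by positivity
  field_simp
  rw [mul_pow, mul_pow, ← pow_mul, mul_comm j 2]
  ring

/-! ### Inner products of the functions `hermiteGauss` -/

theorem integral_eq_mul_integral_comp_affine (f : ℝ → ℝ) {a : ℝ} (ha : 0 < a) (b : ℝ) :
    ∫ x, f x = a * ∫ z, f (a * z - b) := by
  rw [Measure.integral_comp_mul_left (fun x => f (x - b)) a, integral_sub_right_eq_self f b,
    abs_of_pos (inv_pos.mpr ha), smul_eq_mul, mul_inv_cancel_left₀ ha.ne']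

open Polynomial in
theorem inner_hermiteGaussS (θ k γ γ' c c' : ℝ) (n m : ℕ) {s : ℝ}
    (hs : s = (k / thetaMinus θ - (γ + γ')) / √2) :
    inner ℂ (toL2 (hermiteGaussS θ k γ c n)) (toL2 (hermiteGaussS θ k γ' c' m))
      = ((c / √(2 ^ n * (n.factorial : ℝ)) * (c' / √(2 ^ m * (m.factorial : ℝ)))
        * (√2 * thetaMinus θ) * Real.exp ((γ + γ') ^ 2 / 2)
        * gaussInt ((hermiteH n).comp (X + C s) * (hermiteH m).comp (X + C s)) : ℝ) : ℂ) := by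
  rw [inner_toL2]
  simp only [coe_hermiteGaussS, hermiteGauss, Complex.conj_ofReal, ← Complex.ofReal_mul]
  rw [integral_complex_ofReal]
  congr 1
  have hσ := thetaMinus_pos θ
  have h2 : √2 * √2 = 2 := Real.mul_self_sqrt (by norm_num)
  have h6 : thetaPlus θ = 1 / (2 * thetaMinus θ) := by
    rw [eq_div_iff (by positivity)]
    linarith [two_mul_thetaPlus_mul_thetaMinus θ]
  -- The substitution `x = √2 Θ₋ z - Θ₋ (γ + γ')` completes the square in the total exponent,
  -- leaving `-z² + (γ + γ')² / 2`, and shifts the Hermite argument to `z + s`.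
  rw [integral_eq_mul_integral_comp_affine _ (show 0 < √2 * thetaMinus θ by positivity)
    (thetaMinus θ * (γ + γ')), gaussInt]
  have : ∀ A B D I : ℝ, A * B * D * Real.exp ((γ + γ') ^ 2 / 2) * I
      = D * ((A * B * Real.exp ((γ + γ') ^ 2 / 2)) * I) := fun A B D I => by ring
  rw [this]
  congr 1
  rw [← integral_const_mul]
  refine integral_congr_ae (ae_of_all _ fun z => ?_)
  have hz : (√2 * thetaMinus θ * z - thetaMinus θ * (γ + γ') + k) / (√2 * thetaMinus θ) = z + s := by
    rw [hs]
    field_simp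
    ring
  simp only [eval_mul, eval_comp, eval_add, eval_X, eval_C, hz]
  generalize (hermiteH n).eval (z + s) = u
  generalize (hermiteH m).eval (z + s) = v
  rw [mul_mul_mul_comm, ← Real.exp_add, show ∀ A B E F u v : ℝ, A * B * E * (u * v * F)
    = A * u * (B * v) * (E * F) by intros; ring, ← Real.exp_add]
  congr 2
  rw [h6]
  field_simp
  linear_combination (-2 * z ^ 2) * h2

theorem inner_hermiteGaussS_of_add_eq (θ k γ γ' c c' : ℝ) (h : γ + γ' = k / thetaMinus θ)
    (n m : ℕ) :
    inner ℂ (toL2 (hermiteGaussS θ k γ c n)) (toL2 (hermiteGaussS θ k γ' c' m))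
      = if n = m then ((c * c' * (√(2 * Real.pi) * thetaMinus θ)
        * Real.exp (k ^ 2 / (2 * thetaMinus θ ^ 2)) : ℝ) : ℂ) else 0 := by
  rw [inner_hermiteGaussS θ k γ γ' c c' n m (s := 0) (by rw [h]; simp)]
  simp only [map_zero, add_zero, Polynomial.comp_X, gaussInt_hermiteH_mul_hermiteH]
  split_ifs with hnm
  · subst hnm
    congr 1
    have h1 : √(2 ^ n * (n.factorial : ℝ)) * √(2 ^ n * (n.factorial : ℝ)) = 2 ^ n * n.factorial :=
      Real.mul_self_sqrt (by positivity)
    have h2 : √(2 ^ n * (n.factorial : ℝ)) ≠ 0 := by positivity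
    have h3 : (γ + γ') ^ 2 / 2 = k ^ 2 / (2 * thetaMinus θ ^ 2) := by
      have := (thetaMinus_pos θ).ne'
      rw [h]
      field_simp
    generalize √(2 ^ n * (n.factorial : ℝ)) = r at *
    rw [h3, ← h1, Real.sqrt_mul (by norm_num)]
    field_simp
  · simp

theorem norm_sq_hermiteGaussS (θ k γ c : ℝ) (n : ℕ) :
    ‖toL2 (hermiteGaussS θ k γ c n)‖ ^ 2
      = c ^ 2 * (√(2 * Real.pi) * thetaMinus θ) * Real.exp (2 * γ ^ 2)
        * laguerreL n (-(k / thetaMinus θ - 2 * γ) ^ 2) := by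
  have h := inner_self_eq_norm_sq_to_K (𝕜 := ℂ) (toL2 (hermiteGaussS θ k γ c n))
  rw [inner_hermiteGaussS θ k γ γ c c n n rfl, gaussInt_hermiteH_comp_sq] at h
  have h' : ((‖toL2 (hermiteGaussS θ k γ c n)‖ ^ 2 : ℝ) : ℂ) = _ :=
    (Complex.ofReal_pow _ _).trans h.symm
  rw [Complex.ofReal_injective h']
  have h1 : √(2 ^ n * (n.factorial : ℝ)) * √(2 ^ n * (n.factorial : ℝ)) = 2 ^ n * n.factorial :=
    Real.mul_self_sqrt (by positivity)
  have h2 : √(2 ^ n * (n.factorial : ℝ)) ≠ 0 := by positivity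
  have h3 : -(2 * ((k / thetaMinus θ - (γ + γ)) / √2) ^ 2) = -(k / thetaMinus θ - 2 * γ) ^ 2 := by
    rw [div_pow, Real.sq_sqrt (by norm_num)]
    ring
  generalize √(2 ^ n * (n.factorial : ℝ)) = r at *
  rw [h3, ← h1, Real.sqrt_mul (by norm_num), show (γ + γ) ^ 2 / 2 = 2 * γ ^ 2 by ring]
  field_simp

/-- At a nonpositive point all terms of the Laguerre sum are nonnegative; keep the first two. -/
theorem one_add_mul_le_laguerreL_neg (n : ℕ) {x : ℝ} (hx : 0 ≤ x) :
    1 + n * x ≤ laguerreL n (-x) := by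
  cases n with
  | zero => simp [laguerreL]
  | succ n =>
    rw [laguerreL, Finset.sum_range_succ', Finset.sum_range_succ']
    have : 0 ≤ ∑ j ∈ Finset.range n, ((n + 1).choose (j + 1 + 1) : ℝ) * (- -x) ^ (j + 1 + 1)
        / ((j + 1 + 1).factorial : ℝ) := by
      simp only [neg_neg]
      positivity
    simp at this ⊢
    linarith

/-! ### Bases and quasi-bases -/

theorem IsBiorthonormal.symm {v w : ℕ → L2} (h : IsBiorthonormal v w) : IsBiorthonormal w v := by
  intro n m
  rw [← inner_conj_symm, h m n]
  simp [eq_comm, apply_ite]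

/-- In a basis, the maps `T n f = ⟨w n, f⟩ v n` would be pointwise bounded, hence bounded in norm by
Banach-Steinhaus, while `‖T n‖ = ‖v n‖ ‖w n‖`. -/
theorem IsBiorthonormal.not_isBasis {v w : ℕ → L2} (h : IsBiorthonormal v w)
    (hvw : Tendsto (fun n => ‖v n‖ * ‖w n‖) atTop atTop) : ¬ IsBasis v := by
  intro hb
  let T : ℕ → L2 →L[ℂ] L2 := fun n => (innerSL ℂ (w n)).smulRight (v n)
  have hT : ∀ n, ‖T n‖ = ‖v n‖ * ‖w n‖ := fun n => by
    rw [ContinuousLinearMap.norm_smulRight_apply, innerSL_apply_norm, mul_comm]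
  have hbdd : ∀ f : L2, ∃ C, ∀ n, ‖T n f‖ ≤ C := by
    intro f
    obtain ⟨c, hc, -⟩ := hb f
    -- Pairing the partial sums with `w n` forces the coefficients, so their continuity need not be
    -- assumed.
    have hcoef : ∀ n, inner ℂ (w n) f = c n := by
      intro n
      refine tendsto_nhds_unique ((innerSL ℂ (w n)).continuous.tendsto f |>.comp hc) ?_
      refine tendsto_const_nhds.congr' ?_
      filter_upwards [eventually_gt_atTop n] with m hm
      simp only [Function.comp_apply, innerSL_apply_apply, inner_sum, inner_smul_right,
        h.symm n, mul_ite, mul_one, mul_zero]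
      rw [Finset.sum_ite_eq, if_pos (Finset.mem_range.mpr hm)]
    have h0 : Tendsto (fun n => c n • v n) atTop (𝓝 0) := by
      have := (hc.comp (tendsto_add_atTop_nat 1)).sub hc
      simpa [Finset.sum_range_succ] using this
    obtain ⟨C, hC⟩ := h0.norm.bddAbove_range
    refine ⟨C, fun n => ?_⟩
    have : T n f = c n • v n := by
      rw [← hcoef n]; rfl
    rw [this]
    exact hC ⟨n, rfl⟩
  obtain ⟨C, hC⟩ := banach_steinhaus hbdd
  obtain ⟨n, hn⟩ := (hvw.eventually_gt_atTop C).exists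
  exact absurd (hC n) (by rw [hT]; exact not_le.mpr hn)

theorem exp_mul_hermiteGauss (θ k γ c q : ℝ) (n : ℕ) (x : ℝ) :
    (Real.exp (q * x) : ℂ) * hermiteGauss θ k γ c n x
      = hermiteGauss θ k (γ - q * thetaMinus θ) c n x := by
  have hσ := (thetaMinus_pos θ).ne'
  rw [hermiteGauss, hermiteGauss, ← Complex.ofReal_mul, mul_left_comm, ← Real.exp_add]
  congr 3
  field_simp
  ring

theorem hermiteGaussS_mem_calG (θ k γ c : ℝ) (n : ℕ) : toL2 (hermiteGaussS θ k γ c n) ∈ calG := by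
  intro q
  refine (memLp_hermiteGauss θ k (γ - q * thetaMinus θ) c n).ae_eq ?_
  filter_upwards [coeFn_toL2 (hermiteGaussS θ k γ c n)] with x hx
  rw [hx, coe_hermiteGaussS, exp_mul_hermiteGauss]

theorem dense_calG : Dense (calG : Set L2) := by
  -- With these parameters the family is the usual Hermite functions, up to scaling.
  refine (isCompleteFamily_hermiteGaussS 0 0 0 one_ne_zero).mono ?_
  refine Submodule.span_le.mpr ?_
  rintro _ ⟨n, rfl⟩
  exact hermiteGaussS_mem_calG 0 0 0 1 n

theorem inner_hermiteGaussS_eq_of_mem_calG {f : L2} (hf : f ∈ calG) (θ k γ c q r : ℝ) (n : ℕ) :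
    inner ℂ f (toL2 (hermiteGaussS θ k (γ - q * thetaMinus θ) (r * c) n))
      = r * inner ℂ (hf q).toLp (toL2 (hermiteGaussS θ k γ c n)) := by
  rw [L2.inner_def, L2.inner_def, ← integral_const_mul]
  refine integral_congr_ae ?_
  filter_upwards [coeFn_toL2 (hermiteGaussS θ k (γ - q * thetaMinus θ) (r * c) n),
    coeFn_toL2 (hermiteGaussS θ k γ c n), (hf q).coeFn_toLp] with x h1 h2 h3
  rw [h1, h2, h3, coe_hermiteGaussS, coe_hermiteGaussS, ← exp_mul_hermiteGauss]
  simp only [RCLike.inner_apply, map_mul, Complex.conj_ofReal, hermiteGauss]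
  push_cast
  ring

theorem inner_toLp_exp_mul_of_mem_calG {f g : L2} (hf : f ∈ calG) (hg : g ∈ calG) (q : ℝ) :
    inner ℂ (hf q).toLp (hg (-q)).toLp = inner ℂ f g := by
  rw [L2.inner_def, L2.inner_def]
  refine integral_congr_ae ?_
  filter_upwards [(hf q).coeFn_toLp, (hg (-q)).coeFn_toLp] with x h1 h2
  rw [h1, h2]
  simp only [RCLike.inner_apply, map_mul, Complex.conj_ofReal]
  have h : (Real.exp (-q * x) : ℂ) * (Real.exp (q * x) : ℂ) = 1 := by
    rw [← Complex.ofReal_mul, ← Real.exp_add]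
    simp
  linear_combination (g x * starRingEnd ℂ (f x)) * h

/-- Two biorthonormal families of shifted Hermite functions resolve the identity on `𝒢`. -/
theorem hasSum_inner_hermiteGaussS (θ k γ γ' c c' : ℝ) (h : γ + γ' = k / thetaMinus θ)
    (hc : c * c' * (√(2 * Real.pi) * thetaMinus θ)
        * Real.exp (k ^ 2 / (2 * thetaMinus θ ^ 2)) = 1) {f g : L2} (hf : f ∈ calG)
    (hg : g ∈ calG) :
    HasSum (fun n => inner ℂ f (toL2 (hermiteGaussS θ k γ c n))
      * inner ℂ (toL2 (hermiteGaussS θ k γ' c' n)) g) (inner ℂ f g) := by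
  have hσ := thetaMinus_pos θ
  have hpos : 0 < c * c' := by
    have hX : 0 < (√(2 * Real.pi) * thetaMinus θ) * Real.exp (k ^ 2 / (2 * thetaMinus θ ^ 2)) := by
      positivity
    rw [mul_assoc (c * c')] at hc
    exact (pos_iff_pos_of_mul_pos (by rw [hc]; exact one_pos)).mpr hX
  -- The symmetric choice: `δ` is the midpoint of `γ` and `γ'`, and `exp(± q x)` carries the
  -- `δ`-family to the two given ones. Normalising by `d` makes the `δ`-family orthonormal, by `hc`.
  set d := √(c * c') with hd
  have hdd : d * d = c * c' := Real.mul_self_sqrt hpos.le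
  have hd0 : d ≠ 0 := (Real.sqrt_pos.mpr hpos).ne'
  set δ := (γ + γ') / 2 with hδ
  set q := (γ' - γ) / (2 * thetaMinus θ) with hq
  have horth : Orthonormal ℂ fun n => toL2 (hermiteGaussS θ k δ d n) := by
    rw [orthonormal_iff_ite]
    intro n m
    rw [inner_hermiteGaussS_of_add_eq θ k δ δ d d (by rw [← h]; ring), hdd, hc]
    simp
  let b : HilbertBasis ℕ ℂ L2 := HilbertBasis.mk horth
    (Submodule.dense_iff_topologicalClosure_eq_top.mp
      (isCompleteFamily_hermiteGaussS θ k δ hd0)).ge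
  have hb : ∀ n, b n = toL2 (hermiteGaussS θ k δ d n) := fun n => by
    rw [HilbertBasis.coe_mk]
  have hsum := b.hasSum_inner_mul_inner (hf q).toLp (hg (-q)).toLp
  rw [inner_toLp_exp_mul_of_mem_calG] at hsum
  refine hsum.congr_fun fun n => ?_
  have h1 : γ = δ - q * thetaMinus θ := by rw [hδ, hq]; field_simp; ring
  have h2 : γ' = δ - -q * thetaMinus θ := by rw [hδ, hq]; field_simp; ring
  have h3 : c = c / d * d := by field_simp
  have h4 : c' = c' / d * d := by field_simp
  have h5 : c / d * (c' / d) = 1 := by rw [div_mul_div_comm, hdd, div_self hpos.ne']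
  have e1 : inner ℂ f (toL2 (hermiteGaussS θ k γ c n))
      = (c / d : ℝ) * inner ℂ (hf q).toLp (b n) := by
    rw [hb, ← inner_hermiteGaussS_eq_of_mem_calG hf, ← h1, ← h3]
  have e2 : inner ℂ (toL2 (hermiteGaussS θ k γ' c' n)) g
      = (c' / d : ℝ) * inner ℂ (b n) (hg (-q)).toLp := by
    rw [← inner_conj_symm, ← inner_conj_symm (b n), hb, ← Complex.conj_ofReal, ← map_mul,
      ← inner_hermiteGaussS_eq_of_mem_calG hg, ← h2, ← h4]
  rw [e1, e2, mul_mul_mul_comm, ← Complex.ofReal_mul, h5, Complex.ofReal_one, one_mul]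

theorem tendsto_norm_mul_norm {v w : ℕ → L2} {p q x : ℝ} (hp : 0 < p * q) (hx : 0 < x)
    (hv : ∀ n, ‖v n‖ ^ 2 = p * laguerreL n (-x)) (hw : ∀ n, ‖w n‖ ^ 2 = q * laguerreL n (-x)) :
    Tendsto (fun n => ‖v n‖ * ‖w n‖) atTop atTop := by
  have hle : ∀ n : ℕ, √(p * q) * (n * x) ≤ ‖v n‖ * ‖w n‖ := fun n => by
    refine abs_le_of_sq_le_sq' ?_ (by positivity) |>.2
    have hL := one_add_mul_le_laguerreL_neg n hx.le
    have hn : 0 ≤ n * x := by positivity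
    rw [mul_pow, Real.sq_sqrt hp.le, mul_pow ‖v n‖, hv, hw, mul_mul_mul_comm, ← sq (laguerreL n (-x))]
    gcongr
    linarith
  refine tendsto_atTop_mono hle ?_
  exact (tendsto_natCast_atTop_atTop.atTop_mul_const hx).const_mul_atTop (Real.sqrt_pos.mpr hp)

end Swanson
end

/-! ### The main theorem -/

theorem mainTheorem1 (ω lam α β : ℝ) (hω : 0 < ω) (hlam : 0 < lam) (hωlam : 2 * lam < ω)
    (hαβ : α ≠ β) (θ : ℝ) (hθ : θ = 1 / 2 * Real.artanh (2 * lam / ω))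
    (Nφ Nψ : ℝ)
    (hN : Nφ * Nψ = Real.exp (-(Swanson.shiftK α β) ^ 2 / (2 * Swanson.thetaMinus θ ^ 2))
      / (√(2 * Real.pi) * Swanson.thetaMinus θ)) :
    ∃ (hφ : ∀ n, MemLp (Swanson.phi θ α β Nφ n) 2 (volume : Measure ℝ))
      (hψ : ∀ n, MemLp (Swanson.psi θ α β Nψ n) 2 (volume : Measure ℝ)),
      let Φ : ℕ → Swanson.L2 := fun n => (hφ n).toLp
      let Ψ : ℕ → Swanson.L2 := fun n => (hψ n).toLp
      let γA := Swanson.gammaA θ α β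
      let γB := Swanson.gammaB θ α β
      -- eigenvectors of `N = B A`, of its adjoint `N†`, and of `A† B†`
      (∀ n : ℕ, Swanson.IsEigenvector (Swanson.opN θ α β) n (Φ n)) ∧
      (∀ n : ℕ, Swanson.IsEigenvector (Swanson.opN θ α β).adjoint n (Ψ n)) ∧
      (∀ n : ℕ, Swanson.IsEigenvector
        (Swanson.opMul (Swanson.opA θ α β).adjoint (Swanson.opB θ α β).adjoint) n (Ψ n)) ∧
      -- the norms
      (∀ n : ℕ, ‖Φ n‖ ^ 2 = Nφ / Nψ * Real.exp (1 / 2 * (3 * γA ^ 2 - γB ^ 2 - 2 * γA * γB))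
        * Swanson.laguerreL n (-(γB - γA) ^ 2)) ∧
      (∀ n : ℕ, ‖Ψ n‖ ^ 2 = Nψ / Nφ * Real.exp (1 / 2 * (3 * γB ^ 2 - γA ^ 2 - 2 * γA * γB))
        * Swanson.laguerreL n (-(γB - γA) ^ 2)) ∧
      Tendsto (fun n => ‖Φ n‖ * ‖Ψ n‖) atTop atTop ∧
      -- complete, biorthonormal, not bases, quasi-bases
      (Swanson.IsCompleteFamily Φ ∧ Swanson.IsCompleteFamily Ψ) ∧
      Swanson.IsBiorthonormal Φ Ψ ∧
      (¬ Swanson.IsBasis Φ ∧ ¬ Swanson.IsBasis Ψ) ∧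
      Swanson.IsQuasiBases Swanson.calG Φ Ψ := by
  have hσ := Swanson.thetaMinus_pos θ
  have hpi : 0 < √(2 * Real.pi) * Swanson.thetaMinus θ := by positivity
  have hNpos : 0 < Nφ * Nψ := by rw [hN]; positivity
  have hNφ : Nφ ≠ 0 := left_ne_zero_of_mul hNpos.ne'
  have hNψ : Nψ ≠ 0 := right_ne_zero_of_mul hNpos.ne'
  have hAB := Swanson.gammaA_add_gammaB θ α β
  have hBA : Swanson.gammaB θ α β + Swanson.gammaA θ α β
      = Swanson.shiftK α β / Swanson.thetaMinus θ := (add_comm _ _).trans hAB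
  have hd : 0 < (Swanson.gammaB θ α β - Swanson.gammaA θ α β) ^ 2 := by
    have h := Swanson.gammaA_sub_gammaB θ α β
    have : Swanson.gammaB θ α β - Swanson.gammaA θ α β ≠ 0 := by
      rw [← neg_sub, h]
      exact neg_ne_zero.mpr (mul_ne_zero (sub_ne_zero.mpr hαβ) (Real.exp_ne_zero _))
    positivity
  have hκ : Swanson.shiftK α β ^ 2 / (2 * Swanson.thetaMinus θ ^ 2)
      = (Swanson.gammaA θ α β + Swanson.gammaB θ α β) ^ 2 / 2 := by
    rw [hAB]
    field_simp
  have hN1 : Nφ * Nψ * (√(2 * Real.pi) * Swanson.thetaMinus θ)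
      = Real.exp (-((Swanson.gammaA θ α β + Swanson.gammaB θ α β) ^ 2 / 2)) := by
    rw [hN, div_mul_cancel₀ _ hpi.ne', neg_div, hκ]
  -- The normalisation is exactly what makes the constant in the mixed pairing equal to `1`.
  have hone : Nφ * Nψ * (√(2 * Real.pi) * Swanson.thetaMinus θ)
      * Real.exp (Swanson.shiftK α β ^ 2 / (2 * Swanson.thetaMinus θ ^ 2)) = 1 := by
    rw [hN1, hκ, ← Real.exp_add, neg_add_cancel, Real.exp_zero]
  have hone' : Nψ * Nφ * (√(2 * Real.pi) * Swanson.thetaMinus θ)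
      * Real.exp (Swanson.shiftK α β ^ 2 / (2 * Swanson.thetaMinus θ ^ 2)) = 1 := by
    rw [mul_comm Nψ, hone]
  have hnφ : ∀ n, ‖Swanson.toL2 (Swanson.hermiteGaussS θ (Swanson.shiftK α β)
      (Swanson.gammaA θ α β) Nφ n)‖ ^ 2 = Nφ / Nψ * Real.exp (1 / 2 * (3 *
      Swanson.gammaA θ α β ^ 2 - Swanson.gammaB θ α β ^ 2
        - 2 * Swanson.gammaA θ α β * Swanson.gammaB θ α β))
      * Swanson.laguerreL n (-(Swanson.gammaB θ α β - Swanson.gammaA θ α β) ^ 2) := fun n => by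
    -- Write `Nφ² = (Nφ / Nψ) (Nφ Nψ)`; the exponents then combine as `2 γ_A² - (γ_A + γ_B)² / 2`.
    have h1 : Nφ ^ 2 * (√(2 * Real.pi) * Swanson.thetaMinus θ) = Nφ / Nψ
        * Real.exp (-((Swanson.gammaA θ α β + Swanson.gammaB θ α β) ^ 2 / 2)) := by
      rw [← hN1]
      field_simp
    rw [Swanson.norm_sq_hermiteGaussS, h1, mul_assoc (Nφ / Nψ), ← Real.exp_add, ← hAB]
    ring_nf
  have hnψ : ∀ n, ‖Swanson.toL2 (Swanson.hermiteGaussS θ (Swanson.shiftK α β)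
      (Swanson.gammaB θ α β) Nψ n)‖ ^ 2 = Nψ / Nφ * Real.exp (1 / 2 * (3 *
      Swanson.gammaB θ α β ^ 2 - Swanson.gammaA θ α β ^ 2
        - 2 * Swanson.gammaA θ α β * Swanson.gammaB θ α β))
      * Swanson.laguerreL n (-(Swanson.gammaB θ α β - Swanson.gammaA θ α β) ^ 2) := fun n => by
    have h1 : Nψ ^ 2 * (√(2 * Real.pi) * Swanson.thetaMinus θ) = Nψ / Nφ
        * Real.exp (-((Swanson.gammaA θ α β + Swanson.gammaB θ α β) ^ 2 / 2)) := by
      rw [← hN1]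
      field_simp
    rw [Swanson.norm_sq_hermiteGaussS, h1, mul_assoc (Nψ / Nφ), ← Real.exp_add, ← hAB]
    ring_nf
  refine ⟨Swanson.memLp_hermiteGauss _ _ _ _, Swanson.memLp_hermiteGauss _ _ _ _, ?_⟩
  intro Φ Ψ γA γB
  have hΦ : Φ = fun n => Swanson.toL2 (Swanson.hermiteGaussS θ (Swanson.shiftK α β) γA Nφ n) :=
    funext fun n => Swanson.toLp_hermiteGauss _
  have hΨ : Ψ = fun n => Swanson.toL2 (Swanson.hermiteGaussS θ (Swanson.shiftK α β) γB Nψ n) :=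
    funext fun n => Swanson.toLp_hermiteGauss _
  clear_value Φ Ψ
  subst hΦ hΨ
  have hbi : Swanson.IsBiorthonormal
      (fun n => Swanson.toL2 (Swanson.hermiteGaussS θ (Swanson.shiftK α β) γA Nφ n))
      (fun n => Swanson.toL2 (Swanson.hermiteGaussS θ (Swanson.shiftK α β) γB Nψ n)) :=
    fun n m => by
      simp only
      rw [Swanson.inner_hermiteGaussS_of_add_eq _ _ _ _ _ _ hAB, hone, Complex.ofReal_one]
  have hφ0 : ∀ n, Swanson.toL2 (Swanson.hermiteGaussS θ (Swanson.shiftK α β) γA Nφ n) ≠ 0 :=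
    fun n h0 => by
      have := hbi n n
      simp only [h0, inner_zero_left, if_true] at this
      exact zero_ne_one this
  have hψ0 : ∀ n, Swanson.toL2 (Swanson.hermiteGaussS θ (Swanson.shiftK α β) γB Nψ n) ≠ 0 :=
    fun n h0 => by
      have := hbi n n
      simp only [h0, inner_zero_right, if_true] at this
      exact zero_ne_one this
  have hlim : Tendsto (fun n =>
      ‖Swanson.toL2 (Swanson.hermiteGaussS θ (Swanson.shiftK α β) γA Nφ n)‖
      * ‖Swanson.toL2 (Swanson.hermiteGaussS θ (Swanson.shiftK α β) γB Nψ n)‖) atTop atTop := by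
    refine Swanson.tendsto_norm_mul_norm ?_ hd hnφ hnψ
    -- The factors `Nφ / Nψ` and `Nψ / Nφ` cancel, leaving a product of exponentials.
    rw [mul_mul_mul_comm, div_mul_div_comm, mul_comm Nψ, div_self hNpos.ne', one_mul]
    positivity
  have hup : ∀ n, Swanson.toL2 (Swanson.upS θ γA (Swanson.downS θ γB
      (Swanson.hermiteGaussS θ (Swanson.shiftK α β) γB Nψ n)))
      = (n : ℂ) • Swanson.toL2 (Swanson.hermiteGaussS θ (Swanson.shiftK α β) γB Nψ n) := fun n => by
    rw [Swanson.upS_downS_hermiteGaussS _ _ _ _ _ hAB, Swanson.toL2_smul]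
  refine ⟨fun n => ⟨hφ0 n, ?_⟩, fun n => ⟨hψ0 n, ?_⟩, fun n => ⟨hψ0 n, ?_⟩, hnφ, hnψ, hlim,
    ⟨Swanson.isCompleteFamily_hermiteGaussS _ _ _ hNφ,
      Swanson.isCompleteFamily_hermiteGaussS _ _ _ hNψ⟩, hbi,
    ⟨hbi.not_isBasis hlim, hbi.symm.not_isBasis (by simpa only [mul_comm] using hlim)⟩,
    Swanson.dense_calG, fun f hf g hg =>
      ⟨Swanson.hasSum_inner_hermiteGaussS _ _ _ _ _ _ hAB hone hf hg,
        Swanson.hasSum_inner_hermiteGaussS _ _ _ _ _ _ hBA hone' hf hg⟩⟩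
  · have h := Swanson.mapsVec_opN θ α β (Swanson.hermiteGaussS θ (Swanson.shiftK α β) γA Nφ n)
    rwa [Swanson.upS_downS_hermiteGaussS _ _ _ _ _ hBA, Swanson.toL2_smul] at h
  · rw [← hup n]
    exact Swanson.mapsVec_opN_adjoint θ α β _
  · rw [← hup n]
    exact (Swanson.mapsVec_opB_adjoint θ α β _).opMul (Swanson.mapsVec_opA_adjoint θ α β _)
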